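/- Let $k$ be an algebraically closed field. A \emph{tensor category} over $k$ is a $k$-linear abelian rigid monoidal category with $k$-bilinear tensor product, in which all objects have finite length, all Hom spaces are finite dimensional and the unit object $\mathbf 1$ is simple. Let $(G,\Gamma)$ be a matched pair of finite groups: a left action $\rhd:\Gamma\times G\to G$ of $\Gamma$ on the set $G$ and a right action $\lhd:\Gamma\times G\to\Gamma$ of $G$ on the set $\Gamma$ with $s\rhd gh=(s\rhd g)((s\lhd g)\rhd h)$ and $st\lhd g=(s\lhd(t\rhd g))(t\lhd g)$. Let $\mathcal C$ be a $(G,\Gamma)$-crossed tensor category over $k$, that is, a tensor category with the following data (associativity and unit isomorphisms of $\mathcal C$ are suppressed). 1. A $\Gamma$-grading $\mathcal C=\bigoplus_{s\in\Gamma}\mathcal C_s$: full replete subcategories such that every object is a direct sum of objects $X_s\in\mathcal C_s$, $\operatorname{Hom}(X,Y)=0$ for $X\in\mathcal C_s$, $Y\in\mathcal C_t$, $s\ne t$, and $\mathcal C_s\otimes\mathcal C_t\subseteq\mathcal C_{st}$. 2. A right action $\rho$ of $G$ on $\mathcal C$ by $k$-linear autoequivalences $\rho^g$, with natural isomorphisms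 $\rho_2^{g,h}:\rho^g\rho^h\to\rho^{hg}$ and $\rho_0:\mathrm{id}\to\rho^e$ satisfying the usual associativity and unit conditions, such that $\rho^g(\mathcal C_s)=\mathcal C_{s\lhd g}$ (up to isomorphism of objects). 3. Isomorphisms $\gamma^g_{X,Y}:\rho^g(X\otimes Y)\to\rho^{t\rhd g}(X)\otimes\rho^g(Y)$, natural in $X\in\mathcal C$ and $Y\in\mathcal C_t$, and isomorphisms $\gamma^g_0:\rho^g(\mathbf 1)\to\mathbf 1$, such that for all $g,h\in G$, $X\in\mathcal C$, $Y\in\mathcal C_s$, $Z\in\mathcal C_t$: (a) $(\gamma^{t\rhd g}_{X,Y}\otimes\mathrm{id})\,\gamma^g_{X\otimes Y,Z}=(\mathrm{id}\otimes\gamma^g_{Y,Z})\,\gamma^g_{X,Y\otimes Z}$; (b) $(\mathrm{id}\otimes\gamma^g_0)\,\gamma^g_{X,\mathbf 1}=\mathrm{id}_{\rho^g(X)}$ and $(\gamma^{s\rhd g}_0\otimes\mathrm{id})\,\gamma^g_{\mathbf 1,Y}=\mathrm{id}_{\rho^g(Y)}$; (c) $\gamma^{hg}_{X,Y}\,(\rho_2^{g,h})_{X\otimes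 Y}=\big((\rho_2^{(s\lhd h)\rhd g,\,s\rhd h})_X\otimes(\rho_2^{g,h})_Y\big)\,\gamma^g_{\rho^{s\rhd h}(X),\rho^h(Y)}\,\rho^g(\gamma^h_{X,Y})$; (d) $\gamma^{hg}_0\,(\rho_2^{g,h})_{\mathbf 1}=\gamma^g_0\,\rho^g(\gamma^h_0)$; (e) $\gamma^e_{X,Y}\,(\rho_0)_{X\otimes Y}=(\rho_0)_X\otimes(\rho_0)_Y$ and $\gamma^e_0\,(\rho_0)_{\mathbf 1}=\mathrm{id}_{\mathbf 1}$. Let $\mathcal C^G$ be the equivariantization of $\mathcal C$ under $\rho$: its objects are pairs $(X,r)$ with isomorphisms $r^g:\rho^g(X)\to X$ such that $r^g\rho^g(r^h)=r^{hg}(\rho_2^{g,h})_X$ and $r^e(\rho_0)_X=\mathrm{id}_X$, and its morphisms $(X,r)\to(Y,r')$ are the $f:X\to Y$ with $fr^g=r'^g\rho^g(f)$ for all $g$. Then $\mathcal C^G$, with its $k$-linear structure inherited from $\mathcal C$, is a tensor category over $k$, denoted $\mathcal C^{(G,\Gamma)}$, with tensor product $$(X,r)\otimes(Y,r')=(X\otimes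 Y,\tilde r)$$ and unit object $(\mathbf 1,(\gamma^g_0)_{g\in G})$, where for any decomposition $Y=\bigoplus_{s\in\Gamma}Y_s$, $Y_s\in\mathcal C_s$, the morphism $\tilde r^g$ is the composition $$\bigoplus_s\rho^g(X\otimes Y_s)\xrightarrow{\oplus_s\gamma^g_{X,Y_s}}\bigoplus_s\rho^{s\rhd g}(X)\otimes\rho^g(Y_s)\xrightarrow{\oplus_s r^{s\rhd g}\otimes r'^g_s}\bigoplus_sX\otimes Y_{s\lhd g}=X\otimes Y,$$ with $r'^g_s:\rho^g(Y_s)\to Y_{s\lhd g}$ the restriction of $r'^g$; the forgetful functor $\mathcal C^{(G,\Gamma)}\to\mathcal C$ is strict monoidal. Moreover, the monad $T=\bigoplus_{g\in G}\rho^g$ on $\mathcal C$, with multiplication and unit induced by $\rho_2$ and $\rho_0$, is a Hopf monad (a bimonad whose left and right fusion operators are isomorphisms) with respect to the comonoidal structure $T_2(X,Y):T(X\otimes Y)\to T(X)\otimes T(Y)$, $T_0:T(\mathbf 1)\to\mathbf 1$ given by the $\gamma^g_{X,Y_s}$ and the $\gamma^g_0$. The functor $(X,r)\mapsto(X,\,(r^g)_{g}:T(X)\to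 X)$ is an equivalence from $\mathcal C^{(G,\Gamma)}$ to the category of $T$-modules, and under it the tensor product corresponds to $(X,a)\otimes(Y,b)=(X\otimes Y,(a\otimes b)T_2(X,Y))$. -/

import Mathlib

open CategoryTheory Category Limits MonoidalCategory

universe w v u

noncomputable section

namespace CrossedTensor

/-- A matched pair of groups `(G, Γ)`: a left action `s ▷ g` of `Γ` on the set `G` and a right
action `s ◁ g` of `G` on the set `Γ`, compatible with each other. -/
structure MatchedPair (G Γ : Type*) [Group G] [Group Γ] where
  /-- `left s g` is `s ▷ g` -/
  left : Γ → G → G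
  /-- `right s g` is `s ◁ g` -/
  right : Γ → G → Γ
  one_left : ∀ g, left 1 g = g
  mul_left : ∀ s t g, left (s * t) g = left s (left t g)
  right_one : ∀ s, right s 1 = s
  right_mul : ∀ s g h, right s (g * h) = right (right s g) h
  left_mul : ∀ s g h, left s (g * h) = left s g * left (right s g) h
  mul_right : ∀ s t g, right (s * t) g = right s (left t g) * right t g

lemma MatchedPair.left_one {G Γ : Type*} [Group G] [Group Γ] (M : MatchedPair G Γ) (s : Γ) :
    M.left s 1 = 1 := by
  have h := M.left_mul s 1 1
  rw [M.right_one, mul_one] at h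
  exact left_eq_mul.mp h

/-- `C` is a tensor category over `k`: abelian, with `k`-bilinear tensor product, rigid
(all left and right duals exist), locally finite, with simple unit object. -/
structure IsTensorCategory (k : Type w) [Field k] (C : Type u) [Category.{v} C]
    [P : Preadditive C] [Linear k C] [MonoidalCategory C] : Prop where
  abelian : ∃ A : Abelian C, A.toPreadditive = P
  tensor_bilinear : ∃ _ : MonoidalPreadditive C, MonoidalLinear k C
  rigid : Nonempty (RigidCategory C)
  noetherian : ∀ X : C, IsNoetherianObject X
  artinian : ∀ X : C, IsArtinianObject X
  finite_hom : ∀ X Y : C, Module.Finite k (X ⟶ Y)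
  simple_unit : Simple (𝟙_ C)

/-! ### Right actions and equivariant objects -/

section Action

variable (k : Type w) [Field k] (G : Type*) [Group G]
  (C : Type u) [Category.{v} C] [Preadditive C] [Linear k C]

/-- A right action of `G` on `C` by `k`-linear autoequivalences. Here `mul g h` is the natural
isomorphism from `ρ^g ∘ ρ^h` to `ρ^{hg}` (Mathlib composes functors from left to right). -/
structure RightAction where
  functor : G → C ⥤ C
  isEquivalence : ∀ g, (functor g).IsEquivalence
  additive : ∀ g, (functor g).Additive
  linear : ∀ g, (functor g).Linear k
  mul : ∀ g h : G, functor h ⋙ functor g ≅ functor (h * g)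
  one : 𝟭 C ≅ functor 1
  mul_coherence : ∀ (a b c : G) (X : C),
    (mul a b).hom.app ((functor c).obj X) ≫ (mul (b * a) c).hom.app X =
      (functor a).map ((mul b c).hom.app X) ≫ (mul a (c * b)).hom.app X ≫
        eqToHom (by rw [mul_assoc])
  map_one_coherence : ∀ (a : G) (X : C),
    (functor a).map (one.hom.app X) ≫ (mul a 1).hom.app X = eqToHom (by simp)
  one_coherence : ∀ (a : G) (X : C),
    one.hom.app ((functor a).obj X) ≫ (mul 1 a).hom.app X = eqToHom (by simp)

variable {k G C} (ρ : RightAction k G C)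

attribute [instance] RightAction.isEquivalence RightAction.additive RightAction.linear

/-- The identity morphism `ρ^a(X) = ρ^b(X)` for equal `a` and `b`. -/
def RightAction.cast {a b : G} (h : a = b) (X : C) :
    (ρ.functor a).obj X ⟶ (ρ.functor b).obj X :=
  eqToHom (by rw [h])

/-- `G`-equivariant objects `(X, r)`. -/
structure EquivariantObject where
  obj : C
  act : ∀ g : G, (ρ.functor g).obj obj ⟶ obj
  isIso_act : ∀ g, IsIso (act g)
  act_mul : ∀ g h, (ρ.functor g).map (act h) ≫ act g = (ρ.mul g h).hom.app obj ≫ act (h * g)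
  act_one : ρ.one.hom.app obj ≫ act 1 = 𝟙 obj

namespace EquivariantObject

variable {ρ}

/-- `G`-equivariant morphisms. -/
@[ext]
structure Hom (A B : EquivariantObject ρ) where
  hom : A.obj ⟶ B.obj
  comm : ∀ g, A.act g ≫ hom = (ρ.functor g).map hom ≫ B.act g

instance : Category (EquivariantObject ρ) where
  Hom := Hom
  id A := ⟨𝟙 A.obj, by simp⟩
  comp f f' := ⟨f.hom ≫ f'.hom, fun g => by
    rw [← assoc, f.comm, assoc, f'.comm, Functor.map_comp, assoc]⟩
  id_comp f := Hom.ext (Category.id_comp f.hom)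
  comp_id f := Hom.ext (Category.comp_id f.hom)
  assoc f f' f'' := Hom.ext (Category.assoc f.hom f'.hom f''.hom)

@[ext]
lemma hom_ext {A B : EquivariantObject ρ} {f f' : A ⟶ B} (h : f.hom = f'.hom) : f = f' :=
  Hom.ext h

@[simp] lemma id_hom (A : EquivariantObject ρ) : Hom.hom (𝟙 A) = 𝟙 A.obj := rfl

@[simp] lemma comp_hom {A B D : EquivariantObject ρ} (f : A ⟶ B) (f' : B ⟶ D) :
    (f ≫ f').hom = f.hom ≫ f'.hom := rfl

variable {A B : EquivariantObject ρ}

instance : Add (A ⟶ B) := ⟨fun f f' => ⟨f.hom + f'.hom, fun g => by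
  rw [Preadditive.comp_add, f.comm, f'.comm, Functor.map_add, Preadditive.add_comp]⟩⟩

instance : Zero (A ⟶ B) := ⟨⟨0, by simp⟩⟩

instance : Neg (A ⟶ B) := ⟨fun f => ⟨-f.hom, fun g => by
  rw [Preadditive.comp_neg, f.comm, Functor.map_neg, Preadditive.neg_comp]⟩⟩

instance : SMul k (A ⟶ B) := ⟨fun c f => ⟨c • f.hom, fun g => by
  rw [Linear.comp_smul, f.comm, Functor.map_smul, Linear.smul_comp]⟩⟩

@[simp] lemma add_hom (f f' : A ⟶ B) : (f + f').hom = f.hom + f'.hom := rfl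
@[simp] lemma zero_hom : Hom.hom (0 : A ⟶ B) = 0 := rfl
@[simp] lemma neg_hom (f : A ⟶ B) : (-f).hom = -f.hom := rfl
@[simp] lemma smul_hom (c : k) (f : A ⟶ B) : (c • f).hom = c • f.hom := rfl

instance : AddCommGroup (A ⟶ B) where
  add_assoc f f' f'' := hom_ext (add_assoc f.hom f'.hom f''.hom)
  zero_add f := hom_ext (zero_add f.hom)
  add_zero f := hom_ext (add_zero f.hom)
  add_comm f f' := hom_ext (add_comm f.hom f'.hom)
  neg_add_cancel f := hom_ext (neg_add_cancel f.hom)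
  nsmul := nsmulRec
  zsmul := zsmulRec

/-- Equivariant morphisms are added as morphisms of `C`. -/
instance : Preadditive (EquivariantObject ρ) where
  add_comp _ _ _ f f' f'' := hom_ext (Preadditive.add_comp _ _ _ f.hom f'.hom f''.hom)
  comp_add _ _ _ f f' f'' := hom_ext (Preadditive.comp_add _ _ _ f.hom f'.hom f''.hom)

instance : Module k (A ⟶ B) where
  one_smul f := hom_ext (one_smul k f.hom)
  mul_smul a b f := hom_ext (mul_smul a b f.hom)
  smul_zero a := hom_ext (smul_zero a)
  smul_add a f f' := hom_ext (smul_add a f.hom f'.hom)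
  add_smul a b f := hom_ext (add_smul a b f.hom)
  zero_smul f := hom_ext (zero_smul k f.hom)

instance : Linear k (EquivariantObject ρ) where
  smul_comp _ _ _ a f f' := hom_ext (Linear.smul_comp _ _ _ a f.hom f'.hom)
  comp_smul _ _ _ f a f' := hom_ext (Linear.comp_smul _ _ _ f.hom a f'.hom)

variable (ρ) in
/-- The forgetful functor `(X, r) ↦ X`. -/
def forget : EquivariantObject ρ ⥤ C where
  obj A := A.obj
  map f := f.hom

end EquivariantObject

/-! ### The monad of a right action of a finite group -/

variable [HasFiniteBiproducts C] [Fintype G]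

/-- The endofunctor `T = ⨁ g, ρ^g`. -/
def RightAction.sumFunctor : C ⥤ C where
  obj X := ⨁ fun g : G => (ρ.functor g).obj X
  map f := biproduct.map fun g => (ρ.functor g).map f

/-- The inclusion of the summand `ρ^g(X)` in `T(X)`. -/
def RightAction.incl (X : C) (g : G) : (ρ.functor g).obj X ⟶ ρ.sumFunctor.obj X :=
  biproduct.ι (fun g : G => (ρ.functor g).obj X) g

/-- The projection of `T(X)` to the summand `ρ^g(X)`. -/
def RightAction.proj (X : C) (g : G) : ρ.sumFunctor.obj X ⟶ (ρ.functor g).obj X :=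
  biproduct.π (fun g : G => (ρ.functor g).obj X) g

/-- The morphism out of `T(X)` with given components. -/
def RightAction.desc {X Z : C} (f : ∀ g : G, (ρ.functor g).obj X ⟶ Z) :
    ρ.sumFunctor.obj X ⟶ Z :=
  biproduct.desc f

lemma RightAction.incl_desc {X Z : C} (f : ∀ g : G, (ρ.functor g).obj X ⟶ Z) (g : G) :
    ρ.incl X g ≫ ρ.desc f = f g :=
  biproduct.ι_desc f g

lemma RightAction.incl_map {X Y : C} (f : X ⟶ Y) (g : G) :
    ρ.incl X g ≫ ρ.sumFunctor.map f = (ρ.functor g).map f ≫ ρ.incl Y g :=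
  biproduct.ι_map (fun g => (ρ.functor g).map f) g

lemma RightAction.sum_hom_ext {X Z : C} {a b : ρ.sumFunctor.obj X ⟶ Z}
    (h : ∀ g, ρ.incl X g ≫ a = ρ.incl X g ≫ b) : a = b :=
  biproduct.hom_ext' a b h

lemma RightAction.incl_proj_self (X : C) (g : G) : ρ.incl X g ≫ ρ.proj X g = 𝟙 _ :=
  biproduct.ι_π_self _ g

lemma RightAction.incl_proj_ne (X : C) {g h : G} (hgh : g ≠ h) : ρ.incl X g ≫ ρ.proj X h = 0 :=
  biproduct.ι_π_ne _ hgh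

lemma RightAction.sum_total (X : C) : ∑ g, ρ.proj X g ≫ ρ.incl X g = 𝟙 _ := by
  refine ρ.sum_hom_ext fun g => ?_
  rw [Preadditive.comp_sum, Finset.sum_eq_single g, ← assoc, incl_proj_self]
  · simp
  · intro b _ hb
    rw [← assoc, ρ.incl_proj_ne X hb.symm, zero_comp]
  · simp

lemma RightAction.map_sum_hom_ext {X Z : C} (F : C ⥤ C) [F.Additive]
    {a b : F.obj (ρ.sumFunctor.obj X) ⟶ Z}
    (h : ∀ g, F.map (ρ.incl X g) ≫ a = F.map (ρ.incl X g) ≫ b) : a = b := by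
  have e : 𝟙 (F.obj (ρ.sumFunctor.obj X)) = ∑ g, F.map (ρ.proj X g) ≫ F.map (ρ.incl X g) := by
    rw [← F.map_id, ← ρ.sum_total X, F.map_sum]
    simp only [F.map_comp]
  rw [← Category.id_comp a, ← Category.id_comp b, e, Preadditive.sum_comp, Preadditive.sum_comp]
  simp only [Category.assoc, h]

/-- The unit of `T`: `ρ_0` followed by the inclusion of `ρ^e`. -/
def RightAction.unitApp (X : C) : X ⟶ ρ.sumFunctor.obj X :=
  ρ.one.hom.app X ≫ ρ.incl X 1

/-- The multiplication of `T`, with components `ρ^g ρ^h ⟶ ρ^{hg}`. -/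
def RightAction.mulApp (X : C) : ρ.sumFunctor.obj (ρ.sumFunctor.obj X) ⟶ ρ.sumFunctor.obj X :=
  ρ.desc fun g => ∑ h : G,
    (ρ.functor g).map (ρ.proj X h) ≫ (ρ.mul g h).hom.app X ≫ ρ.incl X (h * g)

lemma RightAction.incl_mulApp (X : C) (g h : G) :
    (ρ.functor g).map (ρ.incl X h) ≫ ρ.incl (ρ.sumFunctor.obj X) g ≫ ρ.mulApp X =
      (ρ.mul g h).hom.app X ≫ ρ.incl X (h * g) := by
  rw [RightAction.mulApp, incl_desc, Preadditive.comp_sum, Finset.sum_eq_single h]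
  · rw [← Functor.map_comp_assoc, incl_proj_self]; simp
  · intro b _ hb
    rw [← Functor.map_comp_assoc, ρ.incl_proj_ne X hb.symm]; simp
  · simp

lemma RightAction.eqToHom_incl (X : C) {a b : G} (h : a = b)
    (h' : (ρ.functor a).obj X = (ρ.functor b).obj X) :
    eqToHom h' ≫ ρ.incl X b = ρ.incl X a := by
  subst h; simp

/-- The monad `T = ⨁ g, ρ^g` of the action. -/
def RightAction.monad : Monad C where
  toFunctor := ρ.sumFunctor
  η :=
    { app := ρ.unitApp
      naturality := fun X Y f => by
        simp only [unitApp, Functor.id_map, assoc, incl_map]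
        have := ρ.one.hom.naturality f
        simp only [Functor.id_map] at this
        rw [← assoc, this, assoc] }
  μ :=
    { app := ρ.mulApp
      naturality := fun X Y f => by
        refine ρ.sum_hom_ext fun g => ρ.map_sum_hom_ext _ fun h => ?_
        have := (ρ.mul g h).hom.naturality f
        simp only [Functor.comp_map] at this
        simp only [Functor.comp_map]
        rw [← assoc (ρ.incl _ g), incl_map, assoc, ← Functor.map_comp_assoc, incl_map,
          Functor.map_comp, assoc, incl_mulApp, ← assoc, this]
        rw [← assoc (ρ.incl _ g), ← assoc, incl_mulApp]
        simp only [assoc, incl_map] }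
  assoc X := by
    refine ρ.sum_hom_ext fun a => ρ.map_sum_hom_ext _ fun b =>
      ρ.map_sum_hom_ext (ρ.functor b ⋙ ρ.functor a) fun c => ?_
    simp only [Functor.comp_map, Functor.comp_obj]
    rw [← assoc (ρ.incl _ a), incl_map]
    simp only [assoc]
    rw [← Functor.map_comp_assoc, ← Functor.map_comp_assoc, assoc, incl_mulApp, Functor.map_comp, assoc,
      incl_mulApp]
    rw [← assoc (ρ.incl _ a), ← assoc ((ρ.functor a).map (ρ.incl _ b)), incl_mulApp, assoc]
    have := (ρ.mul a b).hom.naturality (ρ.incl X c)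
    simp only [Functor.comp_map] at this
    rw [← assoc _ ((ρ.mul a b).hom.app _), this, assoc, incl_mulApp,
      ← assoc ((ρ.mul a b).hom.app _), ρ.mul_coherence]
    simp only [assoc]
    rw [ρ.eqToHom_incl X (mul_assoc _ _ _)]
  left_unit X := by
    refine ρ.sum_hom_ext fun g => ?_
    have := ρ.one.hom.naturality (ρ.incl X g)
    simp only [Functor.id_map] at this
    dsimp only
    rw [unitApp, assoc, ← assoc, this, assoc, incl_mulApp, ← assoc, ρ.one_coherence,
      ρ.eqToHom_incl X (mul_one g).symm]
    exact (comp_id _).symm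
  right_unit X := by
    refine ρ.sum_hom_ext fun g => ?_
    dsimp only
    rw [← assoc, incl_map, unitApp, Functor.map_comp, assoc, assoc, incl_mulApp, ← assoc,
      ρ.map_one_coherence, ρ.eqToHom_incl X (one_mul g).symm]
    exact (comp_id _).symm

/-- An equivariant object `(X, r)` as a `T`-module: the morphism `T(X) ⟶ X` with components
`r^g`. -/
def RightAction.toModules : EquivariantObject ρ ⥤ ρ.monad.Algebra where
  obj A :=
    { A := A.obj
      a := ρ.desc A.act
      unit := by
        change ρ.unitApp A.obj ≫ _ = _
        rw [unitApp, assoc, incl_desc, A.act_one]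
      assoc := by
        change ρ.mulApp A.obj ≫ _ = ρ.sumFunctor.map _ ≫ _
        refine ρ.sum_hom_ext fun g => ρ.map_sum_hom_ext _ fun h => ?_
        rw [← assoc (ρ.incl _ g), ← assoc, incl_mulApp, assoc, incl_desc, ← assoc (ρ.incl _ g),
          incl_map, assoc, incl_desc, ← Functor.map_comp_assoc, incl_desc, A.act_mul] }
  map f :=
    { f := f.hom
      h := by
        change ρ.sumFunctor.map f.hom ≫ ρ.desc _ = ρ.desc _ ≫ f.hom
        refine ρ.sum_hom_ext fun g => ?_
        rw [← assoc, incl_map, assoc, incl_desc, ← assoc, incl_desc, f.comm] }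

end Action

/-! ### Hopf monads -/

section Hopf

variable {C : Type u} [Category.{v} C] [MonoidalCategory C]

/-- A monad `T` with a comonoidal structure on its underlying functor is a Hopf monad: the
multiplication and the unit are comonoidal transformations (so that `T` is a bimonad) and the left
and right fusion operators are isomorphisms. -/
structure IsHopfMonad (T : Monad C) (O : T.toFunctor.OplaxMonoidal) : Prop where
  mul_tensor : ∀ X Y : C, T.μ.app (X ⊗ Y) ≫ O.δ X Y =
    T.map (O.δ X Y) ≫ O.δ (T.obj X) (T.obj Y) ≫ (T.μ.app X ⊗ₘ T.μ.app Y)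
  mul_unit : T.μ.app (𝟙_ C) ≫ O.η = T.map O.η ≫ O.η
  unit_tensor : ∀ X Y : C, T.η.app (X ⊗ Y) ≫ O.δ X Y = T.η.app X ⊗ₘ T.η.app Y
  unit_unit : T.η.app (𝟙_ C) ≫ O.η = 𝟙 (𝟙_ C)
  left_fusion : ∀ X Y : C, IsIso (O.δ X (T.obj Y) ≫ T.obj X ◁ T.μ.app Y)
  right_fusion : ∀ X Y : C, IsIso (O.δ (T.obj X) Y ≫ T.μ.app X ▷ T.obj Y)

end Hopf

/-! ### Gradings and crossed actions -/

section Crossed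

variable (k : Type w) [Field k] {G Γ : Type*} [Group G] [Group Γ] [Fintype Γ]

/-- A decomposition `X ≅ ⨁ s, X_s` with `X_s` in the full subcategory `comp s`. -/
structure Decomposition {C : Type u} [Category.{v} C] [Preadditive C] [HasFiniteBiproducts C]
    (comp : Γ → ObjectProperty C) (X : C) where
  piece : Γ → C
  mem : ∀ s, comp s (piece s)
  iso : X ≅ ⨁ piece

namespace Decomposition

variable {C : Type u} [Category.{v} C] [Preadditive C] [HasFiniteBiproducts C]
  {comp : Γ → ObjectProperty C} {X : C} (D : Decomposition comp X)

/-- The inclusion of the homogeneous component `X_s`. -/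
def ι (s : Γ) : D.piece s ⟶ X := biproduct.ι D.piece s ≫ D.iso.inv

/-- The projection to the homogeneous component `X_s`. -/
def π (s : Γ) : X ⟶ D.piece s := D.iso.hom ≫ biproduct.π D.piece s

end Decomposition

variable (Γ) in
/-- A `Γ`-grading by full (replete) subcategories. -/
structure Grading (C : Type u) [Category.{v} C] [Preadditive C] [HasFiniteBiproducts C]
    [MonoidalCategory C] where
  comp : Γ → ObjectProperty C
  isClosedUnderIso : ∀ s, (comp s).IsClosedUnderIsomorphisms
  decomposition : ∀ X : C, Nonempty (Decomposition comp X)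
  hom_eq_zero : ∀ {s t : Γ} {X Y : C}, comp s X → comp t Y → s ≠ t → ∀ f : X ⟶ Y, f = 0
  tensor_mem : ∀ {s t : Γ} {X Y : C}, comp s X → comp t Y → comp (s * t) (X ⊗ Y)

/-- A `(G, Γ)`-crossed action on the monoidal category `C`. The diagrams are those for a strict
category with the associativity and unit isomorphisms of `C` inserted; `action.cast` identifies
`ρ^a(X)` and `ρ^b(X)` for equal group elements `a` and `b`. -/
structure CrossedAction (M : MatchedPair G Γ) (C : Type u) [Category.{v} C] [Preadditive C]
    [HasFiniteBiproducts C] [Linear k C] [MonoidalCategory C] where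
  grading : Grading Γ C
  action : RightAction k G C
  /-- `ρ^g(C_s) = C_{s ◁ g}` -/
  map_comp : ∀ (g : G) (s : Γ),
    (grading.comp s).map (action.functor g) = grading.comp (M.right s g)
  /-- `γ^g_{X,Y}` for `Y` in `C_t` -/
  γ : ∀ (g : G) (X : C) {t : Γ} {Y : C} (_ : grading.comp t Y),
    (action.functor g).obj (X ⊗ Y) ≅
      (action.functor (M.left t g)).obj X ⊗ (action.functor g).obj Y
  γ_natural : ∀ (g : G) {X X' : C} {t : Γ} {Y Y' : C} (hY : grading.comp t Y)
    (hY' : grading.comp t Y') (f : X ⟶ X') (f' : Y ⟶ Y'),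
    (action.functor g).map (f ⊗ₘ f') ≫ (γ g X' hY').hom =
      (γ g X hY).hom ≫ ((action.functor (M.left t g)).map f ⊗ₘ (action.functor g).map f')
  γ₀ : ∀ g : G, (action.functor g).obj (𝟙_ C) ≅ 𝟙_ C
  /-- compatibility of `γ` with associativity -/
  γ_assoc : ∀ (g : G) (X : C) {s t : Γ} {Y Z : C} (hY : grading.comp s Y)
    (hZ : grading.comp t Z),
    (γ g (X ⊗ Y) hZ).hom ≫ (γ (M.left t g) X hY).hom ▷ (action.functor g).obj Z ≫
        (α_ _ _ _).hom =
      (action.functor g).map (α_ X Y Z).hom ≫ (γ g X (grading.tensor_mem hY hZ)).hom ≫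
        (action.cast (M.mul_left s t g) X ⊗ₘ (γ g Y hZ).hom)
  /-- right unit constraint; in a tensor category the unit object always lies in `C_e` -/
  γ_unit_right : ∀ (g : G) (X : C) (h : grading.comp 1 (𝟙_ C)),
    (γ g X h).hom ≫ (action.cast (M.one_left g) X ⊗ₘ (γ₀ g).hom) ≫ (ρ_ _).hom =
      (action.functor g).map (ρ_ X).hom
  /-- left unit constraint -/
  γ_unit_left : ∀ (g : G) {s : Γ} {X : C} (hX : grading.comp s X),
    (γ g (𝟙_ C) hX).hom ≫ (γ₀ (M.left s g)).hom ▷ (action.functor g).obj X ≫ (λ_ _).hom =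
      (action.functor g).map (λ_ X).hom
  /-- compatibility of `γ` with the multiplication of the action -/
  γ_mul : ∀ (g h : G) (X : C) {s : Γ} {Y : C} (hY : grading.comp s Y),
    (action.mul g h).hom.app (X ⊗ Y) ≫ (γ (h * g) X hY).hom =
      (action.functor g).map (γ h X hY).hom ≫
        (γ g ((action.functor (M.left s h)).obj X)
          ((map_comp h s).le _ (ObjectProperty.prop_map_obj _ _ hY))).hom ≫
        (((action.mul (M.left (M.right s h) g) (M.left s h)).hom.app X ≫
          action.cast (M.left_mul s h g).symm X) ⊗ₘ (action.mul g h).hom.app Y)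
  /-- compatibility of `γ₀` with the multiplication of the action -/
  γ₀_mul : ∀ g h : G,
    (action.mul g h).hom.app (𝟙_ C) ≫ (γ₀ (h * g)).hom =
      (action.functor g).map (γ₀ h).hom ≫ (γ₀ g).hom
  /-- compatibility of `γ` with the unit of the action -/
  γ_one : ∀ (X : C) {s : Γ} {Y : C} (hY : grading.comp s Y),
    action.one.hom.app (X ⊗ Y) ≫ (γ 1 X hY).hom =
      (action.one.hom.app X ≫ action.cast (M.left_one s).symm X) ⊗ₘ action.one.hom.app Y
  /-- compatibility of `γ₀` with the unit of the action -/
  γ₀_one : action.one.hom.app (𝟙_ C) ≫ (γ₀ 1).hom = 𝟙 (𝟙_ C)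

namespace CrossedAction

variable {k} {M : MatchedPair G Γ} {C : Type u} [Category.{v} C] [Preadditive C]
  [HasFiniteBiproducts C] [Linear k C] [MonoidalCategory C] (𝒜 : CrossedAction k M C)

/-- The category underlying `C^{(G, Γ)}`: the equivariantization of `C` under `ρ`. -/
abbrev Equivariantization := EquivariantObject 𝒜.action

/-- The restriction `r^g_s : ρ^g(Y_s) ⟶ Y_{s ◁ g}` of `r^g`, for a decomposition of `Y`. -/
def actPiece (B : 𝒜.Equivariantization) (D : Decomposition 𝒜.grading.comp B.obj) (g : G) (s : Γ) :
    (𝒜.action.functor g).obj (D.piece s) ⟶ D.piece (M.right s g) :=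
  (𝒜.action.functor g).map (D.ι s) ≫ B.act g ≫ D.π (M.right s g)

/-- The morphism `ρ^g(X ⊗ Y) ⟶ X ⊗ Y` given on `ρ^g(X ⊗ Y_s)` by `γ^g_{X,Y_s}` followed by
`r^{s ▷ g} ⊗ r'^g_s` and the inclusion of `X ⊗ Y_{s ◁ g}`. -/
def tensorAct (A B : 𝒜.Equivariantization) (D : Decomposition 𝒜.grading.comp B.obj) (g : G) :
    (𝒜.action.functor g).obj (A.obj ⊗ B.obj) ⟶ A.obj ⊗ B.obj :=
  ∑ s : Γ, (𝒜.action.functor g).map (A.obj ◁ D.π s) ≫ (𝒜.γ g A.obj (D.mem s)).hom ≫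
    (A.act (M.left s g) ⊗ₘ 𝒜.actPiece B D g s) ≫ A.obj ◁ D.ι (M.right s g)

/-- A monoidal structure on the equivariantization is the twisted one: the tensor product of
`(X, r)` and `(Y, r')` is `X ⊗ Y` with the action `tensorAct` (for every decomposition of `Y`), the
unit object is the unit object of `C` with the action `γ₀`, and the forgetful functor to `C` is
strict monoidal. -/
structure IsTwistedMonoidal [MonoidalCategory 𝒜.Equivariantization] : Prop where
  tensor_obj : ∀ A B : 𝒜.Equivariantization, (A ⊗ B).obj = A.obj ⊗ B.obj
  tensor_act : ∀ (A B : 𝒜.Equivariantization) (D : Decomposition 𝒜.grading.comp B.obj) (g : G),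
    (A ⊗ B).act g = (𝒜.action.functor g).map (eqToHom (tensor_obj A B)) ≫
      𝒜.tensorAct A B D g ≫ eqToHom (tensor_obj A B).symm
  unit_obj : (𝟙_ 𝒜.Equivariantization).obj = 𝟙_ C
  unit_act : ∀ g : G, (𝟙_ 𝒜.Equivariantization).act g =
    (𝒜.action.functor g).map (eqToHom unit_obj) ≫ (𝒜.γ₀ g).hom ≫ eqToHom unit_obj.symm
  forget_strict : ∃ F : (EquivariantObject.forget 𝒜.action).Monoidal,
    (∀ A B, F.μ A B = eqToHom (tensor_obj A B).symm) ∧ F.ε = eqToHom unit_obj.symm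

variable [Fintype G]

/-- The comonoidal structure `T(X ⊗ Y) ⟶ T(X) ⊗ T(Y)` of `T = ⨁ g, ρ^g`, whose restriction to
`ρ^g(X ⊗ Y_s)` is `γ^g_{X,Y_s}` followed by the inclusion of `ρ^{s ▷ g}(X) ⊗ ρ^g(Y_s)`. -/
def comulApp (X : C) {Y : C} (D : Decomposition 𝒜.grading.comp Y) :
    𝒜.action.monad.obj (X ⊗ Y) ⟶ 𝒜.action.monad.obj X ⊗ 𝒜.action.monad.obj Y :=
  𝒜.action.desc fun g => ∑ s : Γ, (𝒜.action.functor g).map (X ◁ D.π s) ≫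
    (𝒜.γ g X (D.mem s)).hom ≫
      (𝒜.action.incl X (M.left s g) ⊗ₘ
        ((𝒜.action.functor g).map (D.ι s) ≫ 𝒜.action.incl Y g))

/-- The morphism `T(𝟙) ⟶ 𝟙` with components `γ^g_0`. -/
def counitHom : 𝒜.action.monad.obj (𝟙_ C) ⟶ 𝟙_ C :=
  𝒜.action.desc fun g => (𝒜.γ₀ g).hom

end CrossedAction

end Crossed

end CrossedTensor

end

/-! On `X ⊗ Y` with `Y` homogeneous of degree `s`, the morphisms `γ` map the summand `ρ^g (X ⊗ Y)`
of `T (X ⊗ Y)` to the summand `ρ^(s ▷ g) X ⊗ ρ^g Y` of `T X ⊗ T Y`. There are no nonzero morphisms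
between objects of different degrees, so this extends uniquely and naturally to all `Y`, and the
conditions on a crossed action become those of a bimonad `T = ⨁ ρ^g`. Source and target of a fusion
operator are direct sums over `G × G`; on homogeneous objects the operator permutes the summands by
a bijection built from the matched pair and is on each summand an isomorphism made of `γ` and `ρ₂`.
Hence `T` is a Hopf monad.

Equivariant objects are the `T`-modules, since the group law makes every action invertible. A module
is the split coequalizer of free modules, so the fusion operators are invertible at all modules, not
only at the free ones. They let one solve for the unique action on a dual object that makes the
evaluation a morphism of modules; thus modules inherit duals. Finally the forgetful functor is
conservative and preserves kernels and cokernels, so abelianness, finite length and simplicity of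
the unit are inherited from `C`.
-/

noncomputable section

namespace CrossedTensor

/-! ### Modules over bimonads and Hopf monads -/

section HopfModules

open Functor.OplaxMonoidal

/-- A bimonad: a monad whose multiplication and unit are comonoidal transformations. -/
structure IsBimonad {C : Type u} [Category.{v} C] [MonoidalCategory C] (T : Monad C)
    (O : T.toFunctor.OplaxMonoidal) : Prop where
  mul_tensor : ∀ X Y : C, T.μ.app (X ⊗ Y) ≫ O.δ X Y =
    T.map (O.δ X Y) ≫ O.δ (T.obj X) (T.obj Y) ≫ (T.μ.app X ⊗ₘ T.μ.app Y)
  mul_unit : T.μ.app (𝟙_ C) ≫ O.η = T.map O.η ≫ O.η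
  unit_tensor : ∀ X Y : C, T.η.app (X ⊗ Y) ≫ O.δ X Y = T.η.app X ⊗ₘ T.η.app Y
  unit_unit : T.η.app (𝟙_ C) ≫ O.η = 𝟙 (𝟙_ C)

variable {C : Type u} [Category.{v} C]

lemma isIso_app_of_isIso_app_free {D : Type*} [Category* D] {T : Monad C} {F F' : C ⥤ D}
    (τ : T.forget ⋙ F ⟶ T.forget ⋙ F') (hτ : ∀ X, IsIso (τ.app (T.free.obj X)))
    (A : T.Algebra) : IsIso (τ.app A) := by
  let τfree (X : C) : F.obj (T.obj X) ⟶ F'.obj (T.obj X) := τ.app (T.free.obj X)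
  have (X : C) : IsIso (τfree X) := hτ X
  let τA : F.obj A.A ⟶ F'.obj A.A := τ.app A
  let unit : A.A ⟶ T.obj A.A := T.η.app A.A
  have unit_a : unit ≫ A.a = 𝟙 A.A := A.unit
  have nat_a : F.map A.a ≫ τA = τfree A.A ≫ F'.map A.a :=
    τ.naturality (⟨A.a, A.assoc.symm⟩ : T.free.obj A.A ⟶ A)
  have nat_map_a : F'.map (T.map A.a) ≫ inv (τfree A.A) =
      inv (τfree (T.obj A.A)) ≫ F.map (T.map A.a) := by
    rw [IsIso.eq_inv_comp, ← assoc, IsIso.comp_inv_eq]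
    exact (τ.naturality (T.free.map A.a)).symm
  have nat_mul : F'.map (T.μ.app A.A) ≫ inv (τfree A.A) =
      inv (τfree (T.obj A.A)) ≫ F.map (T.μ.app A.A) := by
    rw [IsIso.eq_inv_comp, ← assoc, IsIso.comp_inv_eq]
    exact (τ.naturality (⟨T.μ.app A.A, T.assoc A.A⟩ :
      T.free.obj (T.obj A.A) ⟶ T.free.obj A.A)).symm
  have : IsSplitEpi (F.map A.a) :=
    ⟨⟨⟨F.map unit, by rw [← F.map_comp, unit_a, F.map_id]⟩⟩⟩
  change IsIso τA
  refine ⟨F'.map unit ≫ inv (τfree A.A) ≫ F.map A.a, ?_, ?_⟩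
  · have nat_unit : A.a ≫ unit = T.η.app (T.obj A.A) ≫ T.map A.a := T.η.naturality A.a
    have unit_mul : F'.map (T.η.app (T.obj A.A)) ≫ F'.map (T.μ.app A.A) = 𝟙 _ := by
      rw [← F'.map_comp, T.left_unit]
      exact F'.map_id _
    rw [← cancel_epi (F.map A.a), reassoc_of% nat_a, ← F'.map_comp_assoc, nat_unit,
      F'.map_comp_assoc, reassoc_of% nat_map_a, ← F.map_comp, ← A.assoc, F.map_comp,
      ← reassoc_of% nat_mul, reassoc_of% unit_mul, IsIso.hom_inv_id_assoc,
      comp_id]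
  · rw [assoc, assoc, nat_a, IsIso.inv_hom_id_assoc, ← F'.map_comp, unit_a, F'.map_id]

variable [MonoidalCategory C]

/-- Morphisms into the right dual `Y` of `X` as pairings with `X`. -/
def rightDualHomEquiv (X Y Z : C) [ExactPairing X Y] : (Z ⟶ Y) ≃ (Z ⊗ X ⟶ 𝟙_ C) :=
  (λ_ Y).symm.homToEquiv.trans (tensorRightHomEquiv Z X Y (𝟙_ C)).symm

lemma rightDualHomEquiv_apply {X Y Z : C} [ExactPairing X Y] (f : Z ⟶ Y) :
    rightDualHomEquiv X Y Z f = f ▷ X ≫ ε_ X Y := by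
  simp [rightDualHomEquiv, tensorRightHomEquiv, ← unitors_equal]

/-- Morphisms into the left dual `X` of `Y` as pairings with `Y`. -/
def leftDualHomEquiv (X Y Z : C) [ExactPairing X Y] : (Z ⟶ X) ≃ (Y ⊗ Z ⟶ 𝟙_ C) :=
  (ρ_ X).symm.homToEquiv.trans (tensorLeftHomEquiv Z X Y (𝟙_ C)).symm

lemma leftDualHomEquiv_apply {X Y Z : C} [ExactPairing X Y] (f : Z ⟶ X) :
    leftDualHomEquiv X Y Z f = Y ◁ f ≫ ε_ X Y := by
  simp [leftDualHomEquiv, tensorLeftHomEquiv, unitors_equal]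

variable {T : Monad C} [O : T.toFunctor.OplaxMonoidal]

/-- The left fusion operator `T(Y ⊗ X) ⟶ T(Y) ⊗ X` of a module `X`. -/
def leftFusion (Y : C) (A : T.Algebra) : T.obj (Y ⊗ A.A) ⟶ T.obj Y ⊗ A.A :=
  δ T.toFunctor Y A.A ≫ T.obj Y ◁ A.a

/-- The right fusion operator `T(X ⊗ Y) ⟶ X ⊗ T(Y)` of a module `X`. -/
def rightFusion (A : T.Algebra) (Y : C) : T.obj (A.A ⊗ Y) ⟶ A.A ⊗ T.obj Y :=
  δ T.toFunctor A.A Y ≫ A.a ▷ T.obj Y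

lemma leftFusion_naturality_left {Y Y' : C} (f : Y ⟶ Y') (A : T.Algebra) :
    T.map (f ▷ A.A) ≫ leftFusion Y' A = leftFusion Y A ≫ T.map f ▷ A.A := by
  rw [leftFusion, leftFusion, ← δ_natural_left_assoc, assoc, whisker_exchange]

lemma leftFusion_naturality_right (Y : C) {A B : T.Algebra} (f : A ⟶ B) :
    T.map (Y ◁ f.f) ≫ leftFusion Y B = leftFusion Y A ≫ T.obj Y ◁ f.f := by
  rw [leftFusion, leftFusion, ← δ_natural_right_assoc, assoc, ← whiskerLeft_comp, f.h,
    whiskerLeft_comp]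

lemma rightFusion_naturality_right (A : T.Algebra) {Y Y' : C} (f : Y ⟶ Y') :
    T.map (A.A ◁ f) ≫ rightFusion A Y' = rightFusion A Y ≫ A.A ◁ T.map f := by
  rw [rightFusion, rightFusion, ← δ_natural_right_assoc, assoc, whisker_exchange]

lemma rightFusion_naturality_left {A B : T.Algebra} (f : A ⟶ B) (Y : C) :
    T.map (f.f ▷ Y) ≫ rightFusion B Y = rightFusion A Y ≫ f.f ▷ T.obj Y := by
  rw [rightFusion, rightFusion, ← δ_natural_left_assoc, assoc, ← comp_whiskerRight, f.h,
    comp_whiskerRight]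

namespace IsBimonad

lemma unit_leftFusion (B : IsBimonad T O) (Y : C) (A : T.Algebra) :
    T.η.app (Y ⊗ A.A) ≫ leftFusion Y A = T.η.app Y ▷ A.A := by
  rw [leftFusion, ← assoc, B.unit_tensor, ← id_tensorHom, tensorHom_comp_tensorHom, A.unit,
    comp_id]
  exact tensorHom_id _ _

lemma unit_rightFusion (B : IsBimonad T O) (A : T.Algebra) (Y : C) :
    T.η.app (A.A ⊗ Y) ≫ rightFusion A Y = A.A ◁ T.η.app Y := by
  rw [rightFusion, ← assoc, B.unit_tensor, ← tensorHom_id, tensorHom_comp_tensorHom, A.unit,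
    comp_id]
  exact id_tensorHom _ _

lemma mul_leftFusion (B : IsBimonad T O) (Y : C) (A : T.Algebra) :
    T.μ.app (Y ⊗ A.A) ≫ leftFusion Y A =
      T.map (leftFusion Y A) ≫ leftFusion (T.obj Y) A ≫ T.μ.app Y ▷ A.A := by
  rw [leftFusion, ← assoc, B.mul_tensor, leftFusion, T.map_comp, assoc, assoc, assoc, assoc,
    ← δ_natural_right_assoc, ← MonoidalCategory.tensorHom_def', ← id_tensorHom, ← id_tensorHom,
    tensorHom_comp_tensorHom, tensorHom_comp_tensorHom, A.assoc, id_comp, comp_id]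

lemma mul_rightFusion (B : IsBimonad T O) (A : T.Algebra) (Y : C) :
    T.μ.app (A.A ⊗ Y) ≫ rightFusion A Y =
      T.map (rightFusion A Y) ≫ rightFusion A (T.obj Y) ≫ A.A ◁ T.μ.app Y := by
  rw [rightFusion, ← assoc, B.mul_tensor, rightFusion, T.map_comp, assoc, assoc, assoc, assoc,
    ← δ_natural_left_assoc, ← MonoidalCategory.tensorHom_def, ← tensorHom_id, ← tensorHom_id,
    tensorHom_comp_tensorHom, tensorHom_comp_tensorHom, A.assoc, id_comp, comp_id]

variable (B : IsBimonad T O)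

/-- The tensor product of two modules over a bimonad. -/
abbrev tensorAlgebra (X Y : T.Algebra) : T.Algebra where
  A := X.A ⊗ Y.A
  a := δ T.toFunctor X.A Y.A ≫ (X.a ⊗ₘ Y.a)
  unit := by
    rw [← assoc, B.unit_tensor, tensorHom_comp_tensorHom, X.unit, Y.unit]
    exact id_tensorHom_id _ _
  assoc := by
    rw [← assoc, B.mul_tensor, assoc, assoc, tensorHom_comp_tensorHom, X.assoc, Y.assoc,
      ← tensorHom_comp_tensorHom, δ_natural_assoc, Functor.map_comp, assoc]

/-- The unit object as a module over a bimonad. -/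
abbrev unitAlgebra : T.Algebra where
  A := 𝟙_ C
  a := Functor.OplaxMonoidal.η T.toFunctor
  unit := B.unit_unit
  assoc := B.mul_unit

lemma tensorAlgebra_a_eq_leftFusion (X Y : T.Algebra) :
    (B.tensorAlgebra X Y).a = leftFusion X.A Y ≫ X.a ▷ Y.A := by
  rw [leftFusion, assoc, ← tensorHom_def']

lemma tensorAlgebra_a_eq_rightFusion (X Y : T.Algebra) :
    (B.tensorAlgebra X Y).a = rightFusion X Y.A ≫ X.A ◁ Y.a := by
  rw [rightFusion, assoc, ← MonoidalCategory.tensorHom_def]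

/-- The tensor product of modules over a bimonad, with the constraints of the base category. -/
@[reducible]
def algebraStruct : MonoidalCategoryStruct T.Algebra where
  tensorObj X Y := B.tensorAlgebra X Y
  whiskerLeft X _ _ f :=
    { f := X.A ◁ f.f
      h := by
        rw [← δ_natural_right_assoc, ← id_tensorHom, ← id_tensorHom, tensorHom_comp_tensorHom,
          assoc, tensorHom_comp_tensorHom, f.h, id_comp, comp_id] }
  whiskerRight f Y :=
    { f := f.f ▷ Y.A
      h := by
        rw [← δ_natural_left_assoc, ← tensorHom_id, ← tensorHom_id, tensorHom_comp_tensorHom,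
          assoc, tensorHom_comp_tensorHom, f.h, id_comp, comp_id] }
  tensorHom f g :=
    { f := f.f ⊗ₘ g.f
      h := by
        rw [← δ_natural_assoc, tensorHom_comp_tensorHom, assoc, tensorHom_comp_tensorHom,
          f.h, g.h] }
  tensorUnit := B.unitAlgebra
  associator X Y Z := Monad.Algebra.isoMk (α_ X.A Y.A Z.A) (by
    dsimp only
    have split_right : (X.a ⊗ₘ δ T.toFunctor Y.A Z.A ≫ (Y.a ⊗ₘ Z.a)) =
        T.obj X.A ◁ δ T.toFunctor Y.A Z.A ≫ (X.a ⊗ₘ Y.a ⊗ₘ Z.a) := by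
      rw [← id_tensorHom, tensorHom_comp_tensorHom, id_comp]
    have split_left : (δ T.toFunctor X.A Y.A ≫ (X.a ⊗ₘ Y.a) ⊗ₘ Z.a) =
        δ T.toFunctor X.A Y.A ▷ T.obj Z.A ≫ ((X.a ⊗ₘ Y.a) ⊗ₘ Z.a) := by
      rw [← tensorHom_id, tensorHom_comp_tensorHom, id_comp]
    rw [split_right, split_left, assoc, assoc, associator_naturality,
      Functor.OplaxMonoidal.associativity_assoc])
  leftUnitor X := Monad.Algebra.isoMk (λ_ X.A) (by
    dsimp only
    rw [MonoidalCategory.tensorHom_def, assoc, assoc, leftUnitor_naturality,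
      left_unitality_hom_assoc])
  rightUnitor X := Monad.Algebra.isoMk (ρ_ X.A) (by
    dsimp only
    rw [tensorHom_def', assoc, assoc, rightUnitor_naturality, right_unitality_hom_assoc])

/-- The identities by which the forgetful functor preserves tensor products of modules. -/
@[reducible]
def forgetInducing :
    letI := B.algebraStruct
    Monoidal.InducingFunctorData T.forget :=
  letI := B.algebraStruct
  { μIso := fun _ _ => Iso.refl _
    εIso := Iso.refl _
    whiskerLeft_eq := fun X _ _ f =>
      show X.A ◁ f.f = 𝟙 _ ≫ X.A ◁ f.f ≫ 𝟙 _ by simp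
    whiskerRight_eq := fun f Y =>
      show f.f ▷ Y.A = 𝟙 _ ≫ f.f ▷ Y.A ≫ 𝟙 _ by simp
    tensorHom_eq := fun f g =>
      show (f.f ⊗ₘ g.f) = 𝟙 _ ≫ (f.f ⊗ₘ g.f) ≫ 𝟙 _ by simp
    associator_eq := fun X Y Z =>
      show (α_ X.A Y.A Z.A).hom = (𝟙 _ ≫ (𝟙 _ ⊗ₘ 𝟙 _)) ≫ (α_ X.A Y.A Z.A).hom ≫
        (𝟙 _ ⊗ₘ 𝟙 _) ≫ 𝟙 _ by simp
    leftUnitor_eq := fun X =>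
      show (λ_ X.A).hom = (𝟙 _ ≫ (𝟙 _ ⊗ₘ 𝟙 _)) ≫ (λ_ X.A).hom by simp
    rightUnitor_eq := fun X =>
      show (ρ_ X.A).hom = (𝟙 _ ≫ (𝟙 _ ⊗ₘ 𝟙 _)) ≫ (ρ_ X.A).hom by simp }

/-- The monoidal category of modules over a bimonad. -/
@[reducible]
def algebraMonoidal : MonoidalCategory T.Algebra :=
  letI := B.algebraStruct
  Monoidal.induced T.forget B.forgetInducing

/-- The forgetful functor of the modules over a bimonad is strict monoidal. -/
@[reducible]
def forgetMonoidal :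
    letI := B.algebraMonoidal
    T.forget.Monoidal :=
  letI := B.algebraStruct
  Monoidal.fromInducedMonoidal T.forget B.forgetInducing

end IsBimonad

namespace IsHopfMonad

lemma isBimonad (H : IsHopfMonad T O) : IsBimonad T O :=
  ⟨H.mul_tensor, H.mul_unit, H.unit_tensor, H.unit_unit⟩

lemma isIso_leftFusion (H : IsHopfMonad T O) (A : T.Algebra) (Y : C) : IsIso (leftFusion Y A) :=
  isIso_app_of_isIso_app_free (F := tensorLeft Y ⋙ T.toFunctor) (F' := tensorLeft (T.obj Y))
    { app := leftFusion Y, naturality _ _ f := leftFusion_naturality_right Y f }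
    (H.left_fusion Y) A

lemma isIso_rightFusion (H : IsHopfMonad T O) (A : T.Algebra) (Y : C) : IsIso (rightFusion A Y) :=
  isIso_app_of_isIso_app_free (F := tensorRight Y ⋙ T.toFunctor) (F' := tensorRight (T.obj Y))
    { app A := rightFusion A Y, naturality _ _ f := rightFusion_naturality_left f Y }
    (fun X => H.right_fusion X Y) A

variable (H : IsHopfMonad T O) (A : T.Algebra)

/-- The action of `T` on a right dual `Y` of the module `A`, determined by the requirement that the
evaluation be a morphism of modules. -/
def rightDualAct (Y : C) [ExactPairing A.A Y] : T.obj Y ⟶ Y :=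
  haveI := H.isIso_leftFusion A Y
  (rightDualHomEquiv A.A Y (T.obj Y)).symm
    (inv (leftFusion Y A) ≫ T.map (ε_ A.A Y) ≫ Functor.OplaxMonoidal.η T.toFunctor)

lemma leftFusion_rightDualAct (Y : C) [ExactPairing A.A Y] :
    leftFusion Y A ≫ H.rightDualAct A Y ▷ A.A ≫ ε_ A.A Y =
      T.map (ε_ A.A Y) ≫ Functor.OplaxMonoidal.η T.toFunctor := by
  have := H.isIso_leftFusion A Y
  rw [← rightDualHomEquiv_apply, rightDualAct, Equiv.apply_symm_apply, IsIso.hom_inv_id_assoc]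

/-- The right dual of a module over a Hopf monad. -/
abbrev rightDualAlgebra (Y : C) [ExactPairing A.A Y] : T.Algebra where
  A := Y
  a := H.rightDualAct A Y
  unit := by
    apply (rightDualHomEquiv A.A Y Y).injective
    have unit_nat : ε_ A.A Y ≫ T.η.app (𝟙_ C) = T.η.app (Y ⊗ A.A) ≫ T.map (ε_ A.A Y) :=
      T.η.naturality (ε_ A.A Y)
    rw [rightDualHomEquiv_apply, rightDualHomEquiv_apply, comp_whiskerRight, assoc,
      ← H.isBimonad.unit_leftFusion, assoc, H.leftFusion_rightDualAct, ← reassoc_of% unit_nat,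
      H.unit_unit, comp_id, id_whiskerRight, id_comp]
  assoc := by
    apply (rightDualHomEquiv A.A Y (T.obj (T.obj Y))).injective
    have := H.isIso_leftFusion A Y
    have := H.isIso_leftFusion A (T.obj Y)
    have mul_nat : T.map (T.map (ε_ A.A Y)) ≫ T.μ.app (𝟙_ C) =
        T.μ.app (Y ⊗ A.A) ≫ T.map (ε_ A.A Y) := T.μ.naturality (ε_ A.A Y)
    rw [rightDualHomEquiv_apply, rightDualHomEquiv_apply, ← cancel_epi (leftFusion (T.obj Y) A),
      ← cancel_epi (T.map (leftFusion Y A)), comp_whiskerRight, comp_whiskerRight, assoc, assoc,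
      ← reassoc_of% leftFusion_naturality_left (H.rightDualAct A Y) A, H.leftFusion_rightDualAct,
      ← reassoc_of% H.isBimonad.mul_leftFusion Y A, H.leftFusion_rightDualAct,
      ← T.map_comp_assoc, ← T.map_comp_assoc, assoc, H.leftFusion_rightDualAct, T.map_comp, assoc,
      ← H.mul_unit, reassoc_of% mul_nat]

/-- The evaluation at a right dual as a morphism of modules. -/
def rightDualEval (Y : C) [ExactPairing A.A Y] :
    H.isBimonad.tensorAlgebra (H.rightDualAlgebra A Y) A ⟶ H.isBimonad.unitAlgebra where
  f := ε_ A.A Y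
  h := by
    rw [IsBimonad.tensorAlgebra_a_eq_leftFusion, assoc]
    exact (H.leftFusion_rightDualAct A Y).symm

lemma map_coevaluation_comp_rightDualAct (Y : C) [ExactPairing A.A Y] :
    T.map (η_ A.A Y) ≫ (H.isBimonad.tensorAlgebra A (H.rightDualAlgebra A Y)).a =
      Functor.OplaxMonoidal.η T.toFunctor ≫ η_ A.A Y := by
  let := H.isBimonad.algebraMonoidal
  have := H.isIso_leftFusion A (𝟙_ C)
  generalize hact : (H.isBimonad.tensorAlgebra A (H.rightDualAlgebra A Y)).a = act
  let contract : (A.A ⊗ Y) ⊗ A.A ⟶ A.A := (α_ A.A Y A.A).hom ≫ A.A ◁ ε_ A.A Y ≫ (ρ_ A.A).hom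
  have contract_linear : T.map contract ≫ A.a = leftFusion (A.A ⊗ Y) A ≫ act ▷ A.A ≫ contract := by
    rw [← hact, ← assoc, ← H.isBimonad.tensorAlgebra_a_eq_leftFusion
      (H.isBimonad.tensorAlgebra A (H.rightDualAlgebra A Y))]
    exact ((α_ A (H.rightDualAlgebra A Y) A).hom ≫ A ◁ H.rightDualEval A Y ≫ (ρ_ A).hom).h
  have unitor_linear : T.map (λ_ A.A).hom ≫ A.a =
      leftFusion (𝟙_ C) A ≫ Functor.OplaxMonoidal.η T.toFunctor ▷ A.A ≫ (λ_ A.A).hom := by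
    rw [← assoc, ← H.isBimonad.tensorAlgebra_a_eq_leftFusion H.isBimonad.unitAlgebra]
    exact (λ_ A).hom.h
  have zigzag : η_ A.A Y ▷ A.A ≫ contract = (λ_ A.A).hom := by
    rw [ExactPairing.evaluation_coevaluation_assoc, Iso.inv_hom_id, comp_id]
  refine (tensorRightHomEquiv _ A.A Y A.A).symm.injective ?_
  change _ ▷ A.A ≫ contract = _ ▷ A.A ≫ contract
  rw [← cancel_epi (leftFusion (𝟙_ C) A), comp_whiskerRight, comp_whiskerRight, assoc, assoc,
    zigzag, ← reassoc_of% leftFusion_naturality_left (η_ A.A Y) A, ← unitor_linear,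
    ← contract_linear, ← T.map_comp_assoc, zigzag]

/-- The right dual of a module is its right dual in the monoidal category of modules. -/
@[reducible]
def rightDualPairing (Y : C) [ExactPairing A.A Y] :
    letI := H.isBimonad.algebraMonoidal
    ExactPairing A (H.rightDualAlgebra A Y) :=
  letI := H.isBimonad.algebraMonoidal
  { coevaluation' :=
      { f := η_ A.A Y
        h := H.map_coevaluation_comp_rightDualAct A Y }
    evaluation' := H.rightDualEval A Y
    coevaluation_evaluation' :=
      Monad.Algebra.Hom.ext' _ _ _ _ (ExactPairing.coevaluation_evaluation A.A Y)
    evaluation_coevaluation' :=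
      Monad.Algebra.Hom.ext' _ _ _ _ (ExactPairing.evaluation_coevaluation A.A Y) }

/-- The action of `T` on a left dual `Y` of the module `A`, determined by the requirement that the
evaluation be a morphism of modules. -/
def leftDualAct (Y : C) [ExactPairing Y A.A] : T.obj Y ⟶ Y :=
  haveI := H.isIso_rightFusion A Y
  (leftDualHomEquiv Y A.A (T.obj Y)).symm
    (inv (rightFusion A Y) ≫ T.map (ε_ Y A.A) ≫ Functor.OplaxMonoidal.η T.toFunctor)

lemma rightFusion_leftDualAct (Y : C) [ExactPairing Y A.A] :
    rightFusion A Y ≫ A.A ◁ H.leftDualAct A Y ≫ ε_ Y A.A =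
      T.map (ε_ Y A.A) ≫ Functor.OplaxMonoidal.η T.toFunctor := by
  have := H.isIso_rightFusion A Y
  rw [← leftDualHomEquiv_apply, leftDualAct, Equiv.apply_symm_apply, IsIso.hom_inv_id_assoc]

/-- The left dual of a module over a Hopf monad. -/
abbrev leftDualAlgebra (Y : C) [ExactPairing Y A.A] : T.Algebra where
  A := Y
  a := H.leftDualAct A Y
  unit := by
    apply (leftDualHomEquiv Y A.A Y).injective
    have unit_nat : ε_ Y A.A ≫ T.η.app (𝟙_ C) = T.η.app (A.A ⊗ Y) ≫ T.map (ε_ Y A.A) :=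
      T.η.naturality (ε_ Y A.A)
    rw [leftDualHomEquiv_apply, leftDualHomEquiv_apply, whiskerLeft_comp, assoc,
      ← H.isBimonad.unit_rightFusion, assoc, H.rightFusion_leftDualAct, ← reassoc_of% unit_nat,
      H.unit_unit, comp_id, whiskerLeft_id, id_comp]
  assoc := by
    apply (leftDualHomEquiv Y A.A (T.obj (T.obj Y))).injective
    have := H.isIso_rightFusion A Y
    have := H.isIso_rightFusion A (T.obj Y)
    have mul_nat : T.map (T.map (ε_ Y A.A)) ≫ T.μ.app (𝟙_ C) =
        T.μ.app (A.A ⊗ Y) ≫ T.map (ε_ Y A.A) := T.μ.naturality (ε_ Y A.A)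
    rw [leftDualHomEquiv_apply, leftDualHomEquiv_apply, ← cancel_epi (rightFusion A (T.obj Y)),
      ← cancel_epi (T.map (rightFusion A Y)), whiskerLeft_comp, whiskerLeft_comp, assoc, assoc,
      ← reassoc_of% rightFusion_naturality_right A (H.leftDualAct A Y), H.rightFusion_leftDualAct,
      ← reassoc_of% H.isBimonad.mul_rightFusion A Y, H.rightFusion_leftDualAct,
      ← T.map_comp_assoc, ← T.map_comp_assoc, assoc, H.rightFusion_leftDualAct, T.map_comp, assoc,
      ← H.mul_unit, reassoc_of% mul_nat]

/-- The evaluation at a left dual as a morphism of modules. -/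
def leftDualEval (Y : C) [ExactPairing Y A.A] :
    H.isBimonad.tensorAlgebra A (H.leftDualAlgebra A Y) ⟶ H.isBimonad.unitAlgebra where
  f := ε_ Y A.A
  h := by
    rw [IsBimonad.tensorAlgebra_a_eq_rightFusion, assoc]
    exact (H.rightFusion_leftDualAct A Y).symm

lemma map_coevaluation_comp_leftDualAct (Y : C) [ExactPairing Y A.A] :
    T.map (η_ Y A.A) ≫ (H.isBimonad.tensorAlgebra (H.leftDualAlgebra A Y) A).a =
      Functor.OplaxMonoidal.η T.toFunctor ≫ η_ Y A.A := by
  let := H.isBimonad.algebraMonoidal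
  have := H.isIso_rightFusion A (𝟙_ C)
  generalize hact : (H.isBimonad.tensorAlgebra (H.leftDualAlgebra A Y) A).a = act
  let contract : A.A ⊗ Y ⊗ A.A ⟶ A.A := (α_ A.A Y A.A).inv ≫ ε_ Y A.A ▷ A.A ≫ (λ_ A.A).hom
  have contract_linear : T.map contract ≫ A.a =
      rightFusion A (Y ⊗ A.A) ≫ A.A ◁ act ≫ contract := by
    rw [← hact, ← assoc, ← H.isBimonad.tensorAlgebra_a_eq_rightFusion A
      (H.isBimonad.tensorAlgebra (H.leftDualAlgebra A Y) A)]
    exact ((α_ A (H.leftDualAlgebra A Y) A).inv ≫ H.leftDualEval A Y ▷ A ≫ (λ_ A).hom).h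
  have unitor_linear : T.map (ρ_ A.A).hom ≫ A.a =
      rightFusion A (𝟙_ C) ≫ A.A ◁ Functor.OplaxMonoidal.η T.toFunctor ≫ (ρ_ A.A).hom := by
    rw [← assoc, ← H.isBimonad.tensorAlgebra_a_eq_rightFusion A H.isBimonad.unitAlgebra]
    exact (ρ_ A).hom.h
  have zigzag : A.A ◁ η_ Y A.A ≫ contract = (ρ_ A.A).hom := by
    rw [ExactPairing.coevaluation_evaluation_assoc, Iso.inv_hom_id, comp_id]
  refine (tensorLeftHomEquiv _ Y A.A A.A).symm.injective ?_
  change A.A ◁ _ ≫ contract = A.A ◁ _ ≫ contract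
  rw [← cancel_epi (rightFusion A (𝟙_ C)), whiskerLeft_comp, whiskerLeft_comp, assoc, assoc,
    zigzag, ← reassoc_of% rightFusion_naturality_right A (η_ Y A.A), ← unitor_linear,
    ← contract_linear, ← T.map_comp_assoc, zigzag]

/-- The left dual of a module is its left dual in the monoidal category of modules. -/
@[reducible]
def leftDualPairing (Y : C) [ExactPairing Y A.A] :
    letI := H.isBimonad.algebraMonoidal
    ExactPairing (H.leftDualAlgebra A Y) A :=
  letI := H.isBimonad.algebraMonoidal
  { coevaluation' :=
      { f := η_ Y A.A
        h := H.map_coevaluation_comp_leftDualAct A Y }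
    evaluation' := H.leftDualEval A Y
    coevaluation_evaluation' :=
      Monad.Algebra.Hom.ext' _ _ _ _ (ExactPairing.coevaluation_evaluation Y A.A)
    evaluation_coevaluation' :=
      Monad.Algebra.Hom.ext' _ _ _ _ (ExactPairing.evaluation_coevaluation Y A.A) }

/-- The modules over a Hopf monad on a rigid category form a rigid category. -/
@[reducible]
def algebraRigid [RigidCategory C] :
    letI := H.isBimonad.algebraMonoidal
    RigidCategory T.Algebra :=
  letI := H.isBimonad.algebraMonoidal
  { rightDual := fun A =>
      { rightDual := H.rightDualAlgebra A (A.A)ᘁ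
        exact := H.rightDualPairing A (A.A)ᘁ }
    leftDual := fun A =>
      { leftDual := H.leftDualAlgebra A (ᘁ(A.A))
        exact := H.leftDualPairing A (ᘁ(A.A)) } }

end IsHopfMonad

end HopfModules

/-! ### The comonoidal structure of the monad of a crossed action -/

section Homogeneous

variable {Γ : Type*} [Fintype Γ] {C : Type u} [Category.{v} C] [Preadditive C]
  [HasFiniteBiproducts C]

lemma Decomposition.ι_π_self {comp : Γ → ObjectProperty C} {X : C} (D : Decomposition comp X)
    (s : Γ) : D.ι s ≫ D.π s = 𝟙 _ := by
  simp [Decomposition.ι, Decomposition.π]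

lemma Decomposition.sum_π_ι {comp : Γ → ObjectProperty C} {X : C} (D : Decomposition comp X) :
    ∑ s, D.π s ≫ D.ι s = 𝟙 X := by
  have total : ∑ s, biproduct.π D.piece s ≫ biproduct.ι D.piece s = 𝟙 (⨁ D.piece) :=
    IsBilimit.total (biproduct.isBilimit D.piece)
  calc ∑ s, D.π s ≫ D.ι s
      = D.iso.hom ≫ (∑ s, biproduct.π D.piece s ≫ biproduct.ι D.piece s) ≫ D.iso.inv := by
        simp only [Decomposition.ι, Decomposition.π, Preadditive.sum_comp, Preadditive.comp_sum,
          assoc]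
    _ = 𝟙 X := by rw [total, id_comp, Iso.hom_inv_id]

variable [Group Γ] [MonoidalCategory C] (𝒢 : Grading Γ C)

lemma Grading.comp_π_ι {s : Γ} {Y Z : C} (hZ : 𝒢.comp s Z) (D : Decomposition 𝒢.comp Y)
    (f : Z ⟶ Y) : f ≫ D.π s ≫ D.ι s = f := by
  conv_rhs => rw [← comp_id f, ← D.sum_π_ι, Preadditive.comp_sum]
  rw [Finset.sum_eq_single s]
  · intro t _ ht
    rw [← assoc, 𝒢.hom_eq_zero hZ (D.mem t) ht.symm (f ≫ D.π t), zero_comp]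
  · simp

lemma Grading.map_hom_ext {E : Type*} [Category* E] [Preadditive E] (F : C ⥤ E) [F.Additive]
    {Y : C} {W : E} {a b : F.obj Y ⟶ W}
    (h : ∀ (s : Γ) (Z : C) (_ : 𝒢.comp s Z) (f : Z ⟶ Y), F.map f ≫ a = F.map f ≫ b) : a = b := by
  obtain ⟨D⟩ := 𝒢.decomposition Y
  have total : 𝟙 (F.obj Y) = ∑ s, F.map (D.π s) ≫ F.map (D.ι s) := by
    rw [← F.map_id, ← D.sum_π_ι, F.map_sum]
    simp only [F.map_comp]
  rw [← id_comp a, ← id_comp b, total, Preadditive.sum_comp, Preadditive.sum_comp]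
  simp only [assoc, h _ _ (D.mem _)]

lemma Grading.comp_one_unit [Simple (𝟙_ C)] : 𝒢.comp 1 (𝟙_ C) := by
  obtain ⟨D⟩ := 𝒢.decomposition (𝟙_ C)
  obtain ⟨s, hs⟩ : ∃ s, D.ι s ≠ 0 := by
    by_contra! h
    refine id_nonzero (𝟙_ C) ?_
    simp [← D.sum_π_ι, h]
  have : IsSplitMono (D.ι s) := ⟨⟨⟨D.π s, D.ι_π_self s⟩⟩⟩
  have : IsIso (D.ι s) := isIso_of_mono_of_nonzero hs
  have unit_mem : 𝒢.comp s (𝟙_ C) := (𝒢.isClosedUnderIso s).of_iso (asIso (D.ι s)) (D.mem s)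
  have unit_tensor_mem : 𝒢.comp (s * s) (𝟙_ C ⊗ 𝟙_ C) := 𝒢.tensor_mem unit_mem unit_mem
  obtain rfl : s = 1 := by
    by_contra hne
    refine id_nonzero (𝟙_ C) ?_
    rw [← (λ_ (𝟙_ C)).inv_hom_id,
      𝒢.hom_eq_zero unit_tensor_mem unit_mem (by simpa using hne) (λ_ (𝟙_ C)).hom, comp_zero]
  exact unit_mem

end Homogeneous

lemma RightAction.cast_incl {k : Type w} [Field k] {G : Type*} [Group G] [Fintype G]
    {C : Type u} [Category.{v} C] [Preadditive C] [HasFiniteBiproducts C] [Linear k C]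
    (ρ : RightAction k G C) (X : C) {a b : G} (h : a = b) :
    ρ.cast h X ≫ ρ.incl X b = ρ.incl X a :=
  ρ.eqToHom_incl X h _

namespace CrossedAction

variable {k : Type w} [Field k] {G Γ : Type*} [Group G] [Group Γ] [Fintype G] [Fintype Γ]
  {M : MatchedPair G Γ} {C : Type u} [Category.{v} C] [Preadditive C]
  [HasFiniteBiproducts C] [Linear k C] [MonoidalCategory C]
  (𝒜 : CrossedAction k M C)

/-- The counit `T(𝟙) ⟶ 𝟙`, with source stated through the functor underlying the monad `T`, for
which the rules of calculation with `incl` and `desc` are formulated. -/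
def counit : 𝒜.action.sumFunctor.obj (𝟙_ C) ⟶ 𝟙_ C :=
  𝒜.counitHom

lemma incl_counit (g : G) : 𝒜.action.incl (𝟙_ C) g ≫ 𝒜.counit = (𝒜.γ₀ g).hom :=
  𝒜.action.incl_desc _ g

/-- The comultiplication `T(X ⊗ Y) ⟶ T(X) ⊗ T(Y)` computed with a decomposition of `Y`: this is
`comulApp`, stated through the functor underlying `T` in the same way as `counit`. -/
def comulOf (X : C) {Y : C} (D : Decomposition 𝒜.grading.comp Y) :
    𝒜.action.sumFunctor.obj (X ⊗ Y) ⟶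
      𝒜.action.sumFunctor.obj X ⊗ 𝒜.action.sumFunctor.obj Y :=
  𝒜.comulApp X D

lemma incl_comulOf (X : C) {Y : C} (D : Decomposition 𝒜.grading.comp Y) (g : G) :
    𝒜.action.incl (X ⊗ Y) g ≫ 𝒜.comulOf X D =
      ∑ s : Γ, (𝒜.action.functor g).map (X ◁ D.π s) ≫ (𝒜.γ g X (D.mem s)).hom ≫
        (𝒜.action.incl X (M.left s g) ⊗ₘ
          ((𝒜.action.functor g).map (D.ι s) ≫ 𝒜.action.incl Y g)) :=
  𝒜.action.incl_desc _ g

/-- The comultiplication `T(X ⊗ Y) ⟶ T(X) ⊗ T(Y)`; it does not depend on the decomposition of `Y`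
chosen here. -/
def comul (X Y : C) : 𝒜.action.sumFunctor.obj (X ⊗ Y) ⟶
    𝒜.action.sumFunctor.obj X ⊗ 𝒜.action.sumFunctor.obj Y :=
  𝒜.comulOf X (𝒜.grading.decomposition Y).some

lemma mulApp_counit :
    𝒜.action.mulApp (𝟙_ C) ≫ 𝒜.counit = 𝒜.action.sumFunctor.map 𝒜.counit ≫ 𝒜.counit := by
  refine 𝒜.action.sum_hom_ext fun g => 𝒜.action.map_sum_hom_ext _ fun h => ?_
  have incl_mul := 𝒜.action.incl_mulApp (𝟙_ C) g h
  rw [reassoc_of% incl_mul, ← assoc (𝒜.action.incl _ g), 𝒜.action.incl_map, assoc,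
    incl_counit, incl_counit, ← Functor.map_comp_assoc, incl_counit, 𝒜.γ₀_mul]

lemma unitApp_counit : 𝒜.action.unitApp (𝟙_ C) ≫ 𝒜.counit = 𝟙 _ := by
  rw [RightAction.unitApp, assoc, incl_counit, 𝒜.γ₀_one]

variable [MonoidalPreadditive C]

lemma map_tensor_comulOf (g : G) {X X' Y Z : C} {s : Γ} (hZ : 𝒜.grading.comp s Z)
    (D : Decomposition 𝒜.grading.comp Y) (p : X' ⟶ X) (q : Z ⟶ Y) :
    (𝒜.action.functor g).map (p ⊗ₘ q) ≫ 𝒜.action.incl (X ⊗ Y) g ≫ 𝒜.comulOf X D =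
      (𝒜.γ g X' hZ).hom ≫ (((𝒜.action.functor (M.left s g)).map p ≫
        𝒜.action.incl X (M.left s g)) ⊗ₘ ((𝒜.action.functor g).map q ≫ 𝒜.action.incl Y g)) := by
  have tensor_whiskerLeft (t : Γ) : (p ⊗ₘ q) ≫ X ◁ D.π t = p ⊗ₘ (q ≫ D.π t) := by
    rw [← id_tensorHom, tensorHom_comp_tensorHom, comp_id]
  rw [incl_comulOf, Preadditive.comp_sum, Finset.sum_eq_single s]
  · have natural := 𝒜.γ_natural g hZ (D.mem s) p (q ≫ D.π s)
    have map_q : (𝒜.action.functor g).map (q ≫ D.π s) ≫ (𝒜.action.functor g).map (D.ι s) =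
        (𝒜.action.functor g).map q := by
      rw [← Functor.map_comp, assoc, 𝒜.grading.comp_π_ι hZ]
    rw [← Functor.map_comp_assoc, tensor_whiskerLeft, reassoc_of% natural,
      tensorHom_comp_tensorHom, reassoc_of% map_q]
  · intro t _ ht
    rw [← Functor.map_comp_assoc, tensor_whiskerLeft,
      𝒜.grading.hom_eq_zero hZ (D.mem t) ht.symm (q ≫ D.π t)]
    simp
  · simp

lemma map_tensor_comul (g : G) {X X' Y Z : C} {s : Γ} (hZ : 𝒜.grading.comp s Z)
    (p : X' ⟶ X) (q : Z ⟶ Y) :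
    (𝒜.action.functor g).map (p ⊗ₘ q) ≫ 𝒜.action.incl (X ⊗ Y) g ≫ 𝒜.comul X Y =
      (𝒜.γ g X' hZ).hom ≫ (((𝒜.action.functor (M.left s g)).map p ≫
        𝒜.action.incl X (M.left s g)) ⊗ₘ ((𝒜.action.functor g).map q ≫ 𝒜.action.incl Y g)) :=
  𝒜.map_tensor_comulOf g hZ _ p q

lemma map_whiskerLeft_comul (g : G) {X Y Z : C} {s : Γ} (hZ : 𝒜.grading.comp s Z)
    (q : Z ⟶ Y) :
    (𝒜.action.functor g).map (X ◁ q) ≫ 𝒜.action.incl (X ⊗ Y) g ≫ 𝒜.comul X Y =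
      (𝒜.γ g X hZ).hom ≫ (𝒜.action.incl X (M.left s g) ⊗ₘ
        ((𝒜.action.functor g).map q ≫ 𝒜.action.incl Y g)) := by
  rw [← id_tensorHom, map_tensor_comul 𝒜 g hZ, CategoryTheory.Functor.map_id, id_comp]

lemma tensor_hom_ext {X Y W : C} {a b : 𝒜.action.sumFunctor.obj (X ⊗ Y) ⟶ W}
    (h : ∀ (g : G) (s : Γ) (Z : C) (_ : 𝒜.grading.comp s Z) (q : Z ⟶ Y),
      (𝒜.action.functor g).map (X ◁ q) ≫ 𝒜.action.incl (X ⊗ Y) g ≫ a =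
        (𝒜.action.functor g).map (X ◁ q) ≫ 𝒜.action.incl (X ⊗ Y) g ≫ b) : a = b :=
  𝒜.action.sum_hom_ext fun g =>
    𝒜.grading.map_hom_ext (tensorLeft X ⋙ 𝒜.action.functor g) fun s Z hZ q => h g s Z hZ q

lemma comul_eq_comulOf (X : C) {Y : C} (D : Decomposition 𝒜.grading.comp Y) :
    𝒜.comul X Y = 𝒜.comulOf X D := by
  refine 𝒜.tensor_hom_ext fun g s Z hZ q => ?_
  rw [← id_tensorHom]
  exact (𝒜.map_tensor_comul g hZ _ q).trans (𝒜.map_tensor_comulOf g hZ D _ q).symm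

lemma comul_naturality {X X' Y Y' : C} (p : X ⟶ X') (q : Y ⟶ Y') :
    𝒜.action.sumFunctor.map (p ⊗ₘ q) ≫ 𝒜.comul X' Y' =
      𝒜.comul X Y ≫ (𝒜.action.sumFunctor.map p ⊗ₘ 𝒜.action.sumFunctor.map q) := by
  refine 𝒜.tensor_hom_ext fun g s Z hZ f => ?_
  rw [reassoc_of% 𝒜.map_whiskerLeft_comul g hZ f, ← assoc (𝒜.action.incl _ g),
    𝒜.action.incl_map, assoc, ← Functor.map_comp_assoc, ← id_tensorHom, tensorHom_comp_tensorHom,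
    id_comp, map_tensor_comul 𝒜 g hZ, tensorHom_comp_tensorHom, 𝒜.action.incl_map, assoc,
    𝒜.action.incl_map, Functor.map_comp, assoc]

lemma comul_assoc (X Y Z : C) :
    𝒜.comul (X ⊗ Y) Z ≫ 𝒜.comul X Y ▷ 𝒜.action.sumFunctor.obj Z ≫ (α_ _ _ _).hom =
      𝒜.action.sumFunctor.map (α_ X Y Z).hom ≫ 𝒜.comul X (Y ⊗ Z) ≫
        𝒜.action.sumFunctor.obj X ◁ 𝒜.comul Y Z := by
  refine 𝒜.tensor_hom_ext fun g t Z' hZ q => ?_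
  refine 𝒜.grading.map_hom_ext (tensorLeft X ⋙ tensorRight Z' ⋙ 𝒜.action.functor g)
    fun s Y' hY p => ?_
  change (𝒜.action.functor g).map ((X ◁ p) ▷ Z') ≫ _ =
    (𝒜.action.functor g).map ((X ◁ p) ▷ Z') ≫ _
  rw [← Functor.map_comp_assoc, ← Functor.map_comp_assoc, ← MonoidalCategory.tensorHom_def,
    reassoc_of% 𝒜.map_tensor_comul g hZ (X ◁ p) q, ← tensorHom_id,
    tensorHom_comp_tensorHom_assoc, assoc, map_whiskerLeft_comul 𝒜 _ hY, comp_id]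
  rw [← assoc (𝒜.action.incl _ g), 𝒜.action.incl_map, assoc, ← Functor.map_comp_assoc,
    ← id_tensorHom, associator_naturality, Functor.map_comp_assoc,
    reassoc_of% 𝒜.map_tensor_comul g (𝒜.grading.tensor_mem hY hZ) (𝟙 X) (p ⊗ₘ q), ← id_tensorHom,
    tensorHom_comp_tensorHom, assoc, assoc, map_tensor_comul 𝒜 g hZ, comp_id,
    CategoryTheory.Functor.map_id, id_comp]
  have γ_assoc := 𝒜.γ_assoc g X hY hZ
  rw [← 𝒜.action.cast_incl X (M.mul_left s t g),
    ← tensorHom_comp_tensorHom (𝒜.action.cast (M.mul_left s t g) X), ← reassoc_of% γ_assoc,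
    ← associator_naturality, ← tensorHom_id, tensorHom_comp_tensorHom_assoc, id_comp]

lemma comul_counit_left (X : C) :
    𝒜.comul (𝟙_ C) X ≫ 𝒜.counit ▷ 𝒜.action.sumFunctor.obj X ≫ (λ_ _).hom =
      𝒜.action.sumFunctor.map (λ_ X).hom := by
  refine 𝒜.tensor_hom_ext fun g s Z hZ q => ?_
  rw [reassoc_of% 𝒜.map_whiskerLeft_comul g hZ q, ← tensorHom_id, tensorHom_comp_tensorHom_assoc,
    incl_counit, comp_id, MonoidalCategory.tensorHom_def, assoc,
    leftUnitor_naturality, 𝒜.action.incl_map, ← Functor.map_comp_assoc, leftUnitor_naturality,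
    Functor.map_comp, ← 𝒜.γ_unit_left g hZ]
  simp only [assoc]

lemma comul_counit_right [Simple (𝟙_ C)] (X : C) :
    𝒜.comul X (𝟙_ C) ≫ 𝒜.action.sumFunctor.obj X ◁ 𝒜.counit ≫ (ρ_ _).hom =
      𝒜.action.sumFunctor.map (ρ_ X).hom := by
  refine 𝒜.action.sum_hom_ext fun g => ?_
  have unit_mem := 𝒜.grading.comp_one_unit
  have incl_comul := 𝒜.map_whiskerLeft_comul g (X := X) unit_mem (𝟙 (𝟙_ C))
  rw [whiskerLeft_id, CategoryTheory.Functor.map_id, CategoryTheory.Functor.map_id, id_comp,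
    id_comp] at incl_comul
  rw [reassoc_of% incl_comul, ← id_tensorHom, tensorHom_comp_tensorHom_assoc, incl_counit,
    comp_id, 𝒜.action.incl_map, ← 𝒜.γ_unit_right g X unit_mem,
    ← 𝒜.action.cast_incl X (M.one_left g)]
  simp only [assoc]
  rw [← rightUnitor_naturality, ← tensorHom_id, tensorHom_comp_tensorHom_assoc, comp_id]

/-- The comonoidal structure of the monad `T = ⨁ g, ρ^g`. -/
@[reducible]
def oplaxMonoidal [Simple (𝟙_ C)] : 𝒜.action.sumFunctor.OplaxMonoidal where
  η := 𝒜.counit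
  δ := 𝒜.comul
  δ_natural_left f X' := by
    rw [← tensorHom_id, ← tensorHom_id, ← CategoryTheory.Functor.map_id, comul_naturality]
  δ_natural_right X' f := by
    rw [← id_tensorHom, ← id_tensorHom, ← CategoryTheory.Functor.map_id, comul_naturality]
  oplax_associativity := 𝒜.comul_assoc
  oplax_left_unitality X := by
    rw [← cancel_mono (λ_ (𝒜.action.sumFunctor.obj X)).hom, assoc, assoc, comul_counit_left,
      Iso.inv_hom_id, ← Functor.map_comp, Iso.inv_hom_id, CategoryTheory.Functor.map_id]
  oplax_right_unitality X := by
    rw [← cancel_mono (ρ_ (𝒜.action.sumFunctor.obj X)).hom, assoc, assoc, comul_counit_right,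
      Iso.inv_hom_id, ← Functor.map_comp, Iso.inv_hom_id, CategoryTheory.Functor.map_id]

lemma mulApp_comul (X Y : C) :
    𝒜.action.mulApp (X ⊗ Y) ≫ 𝒜.comul X Y =
      𝒜.action.sumFunctor.map (𝒜.comul X Y) ≫ 𝒜.comul _ _ ≫
        (𝒜.action.mulApp X ⊗ₘ 𝒜.action.mulApp Y) := by
  refine 𝒜.action.sum_hom_ext fun g => 𝒜.action.map_sum_hom_ext _ fun h => ?_
  refine 𝒜.grading.map_hom_ext
    (tensorLeft X ⋙ 𝒜.action.functor h ⋙ 𝒜.action.functor g) fun s Z hZ q => ?_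
  change (𝒜.action.functor g).map ((𝒜.action.functor h).map (X ◁ q)) ≫ _ =
    (𝒜.action.functor g).map ((𝒜.action.functor h).map (X ◁ q)) ≫ _
  have incl_mul := 𝒜.action.incl_mulApp (X ⊗ Y) g h
  have incl_mul_left := 𝒜.action.incl_mulApp X (M.left (M.right s h) g) (M.left s h)
  have incl_mul_right := 𝒜.action.incl_mulApp Y g h
  have mul_natural_tensor := (𝒜.action.mul g h).hom.naturality (X ◁ q)
  have mul_natural := (𝒜.action.mul g h).hom.naturality q
  rw [Functor.comp_map] at mul_natural_tensor mul_natural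
  have map_mem := (𝒜.map_comp h s).le _ (ObjectProperty.prop_map_obj _ (𝒜.action.functor h) hZ)
  rw [reassoc_of% incl_mul, reassoc_of% mul_natural_tensor, map_whiskerLeft_comul 𝒜 _ hZ,
    ← assoc (𝒜.action.incl _ g), 𝒜.action.incl_map, assoc, ← Functor.map_comp_assoc,
    ← Functor.map_comp_assoc, assoc, map_whiskerLeft_comul 𝒜 _ hZ, Functor.map_comp_assoc,
    reassoc_of% 𝒜.map_tensor_comul g map_mem (𝒜.action.incl X (M.left s h))
      ((𝒜.action.functor h).map q ≫ 𝒜.action.incl Y h),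
    tensorHom_comp_tensorHom, assoc, incl_mul_left, assoc,
    Functor.map_comp, assoc, incl_mul_right, reassoc_of% mul_natural]
  have γ_mul := 𝒜.γ_mul g h X hZ
  rw [reassoc_of% γ_mul, tensorHom_comp_tensorHom, assoc, 𝒜.action.cast_incl]

lemma unitApp_comul (X Y : C) :
    𝒜.action.unitApp (X ⊗ Y) ≫ 𝒜.comul X Y = 𝒜.action.unitApp X ⊗ₘ 𝒜.action.unitApp Y := by
  refine 𝒜.grading.map_hom_ext (tensorLeft X) fun s Z hZ q => ?_
  change X ◁ q ≫ _ = X ◁ q ≫ _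
  have one_natural_tensor := 𝒜.action.one.hom.naturality (X ◁ q)
  have one_natural := 𝒜.action.one.hom.naturality q
  rw [Functor.id_map] at one_natural_tensor one_natural
  have γ_one := 𝒜.γ_one X hZ
  rw [RightAction.unitApp, assoc, reassoc_of% one_natural_tensor, map_whiskerLeft_comul 𝒜 _ hZ,
    reassoc_of% γ_one, tensorHom_comp_tensorHom, assoc, 𝒜.action.cast_incl,
    ← reassoc_of% one_natural, ← id_tensorHom, tensorHom_comp_tensorHom, id_comp]
  rfl

/-- The comonoidal structure of `T = ⨁ g, ρ^g` as a structure on the bundled monad. -/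
instance monadOplaxMonoidal [Simple (𝟙_ C)] : 𝒜.action.monad.toFunctor.OplaxMonoidal :=
  𝒜.oplaxMonoidal

lemma isBimonad [Simple (𝟙_ C)] : IsBimonad 𝒜.action.monad 𝒜.monadOplaxMonoidal where
  mul_tensor := 𝒜.mulApp_comul
  mul_unit := 𝒜.mulApp_counit
  unit_tensor := 𝒜.unitApp_comul
  unit_unit := 𝒜.unitApp_counit

end CrossedAction

/-! ### Invertibility of the fusion operators -/

section Bicone

variable {C : Type u} [Category.{v} C] {J K : Type*}

lemma isIso_of_comp_eq_bicone_ι [Preadditive C] [Finite J] {A : C} {P : J → C} {Q : K → C}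
    {b : Bicone Q} (hb : b.IsBilimit) (f : A ⟶ b.pt) (ι : ∀ j, P j ⟶ A)
    (hι : ∀ {Z : C} {p q : A ⟶ Z}, (∀ j, ι j ≫ p = ι j ≫ q) → p = q)
    {σ : J → K} (hσ : Function.Bijective σ) (e : ∀ j, P j ⟶ Q (σ j)) [∀ j, IsIso (e j)]
    (hf : ∀ j, ι j ≫ f = e j ≫ b.ι (σ j)) : IsIso f := by
  have := Fintype.ofFinite J
  let inverse : b.pt ⟶ A := ∑ j, b.π (σ j) ≫ inv (e j) ≫ ι j
  have ι_inverse (j : J) : b.ι (σ j) ≫ inverse = inv (e j) ≫ ι j := by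
    rw [Preadditive.comp_sum, Finset.sum_eq_single j, bicone_ι_π_self_assoc]
    · intro i _ hi
      rw [bicone_ι_π_ne_assoc b (hσ.injective.ne hi.symm), zero_comp]
    · simp
  refine ⟨inverse, hι fun j => ?_, hb.isColimit.hom_ext fun ⟨l⟩ => ?_⟩
  · rw [reassoc_of% hf, ι_inverse, IsIso.hom_inv_id_assoc, comp_id]
  · obtain ⟨j, rfl⟩ := hσ.surjective l
    change b.ι (σ j) ≫ inverse ≫ f = b.ι (σ j) ≫ 𝟙 _
    rw [reassoc_of% ι_inverse, hf, IsIso.inv_hom_id_assoc, comp_id]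

variable [Preadditive C] [MonoidalCategory C] [MonoidalPreadditive C] {P : J → C} {Q : K → C}

/-- The tensor product of two bicones, indexed by pairs. -/
abbrev tensorBicone (b : Bicone P) (c : Bicone Q) :
    Bicone fun i : J × K => P i.1 ⊗ Q i.2 where
  pt := b.pt ⊗ c.pt
  π i := b.π i.1 ⊗ₘ c.π i.2
  ι i := b.ι i.1 ⊗ₘ c.ι i.2
  ι_π := by
    rintro ⟨i, k⟩ ⟨j, l⟩
    split_ifs with h
    · obtain ⟨rfl, rfl⟩ := Prod.mk.inj h
      simp [tensorHom_comp_tensorHom]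
    · rw [tensorHom_comp_tensorHom]
      obtain hij | hkl := not_and_or.mp fun ⟨hij, hkl⟩ => h (Prod.ext hij hkl)
      · rw [bicone_ι_π_ne b hij, MonoidalPreadditive.zero_tensor]
      · rw [bicone_ι_π_ne c hkl, MonoidalPreadditive.tensor_zero]

/-- The tensor product of two biproducts is a biproduct. -/
def isBilimitTensorBicone [Fintype J] [Fintype K] {b : Bicone P} {c : Bicone Q}
    (hb : b.IsBilimit) (hc : c.IsBilimit) : (tensorBicone b c).IsBilimit :=
  isBilimitOfTotal _ <| by
    rw [Fintype.sum_prod_type, ← id_tensorHom_id, ← IsBilimit.total hb, ← IsBilimit.total hc,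
      sum_tensor]
    simp only [tensorHom_comp_tensorHom, tensor_sum]

end Bicone

lemma Grading.isIso_app {Γ : Type*} [Fintype Γ] [Group Γ] {C : Type u} [Category.{v} C]
    [Preadditive C] [HasFiniteBiproducts C] [MonoidalCategory C] (𝒢 : Grading Γ C)
    {E : Type*} [Category* E] [Preadditive E] {F F' : C ⥤ E} [F.Additive] [F'.Additive]
    (τ : F ⟶ F') (hτ : ∀ (s : Γ) (Z : C), 𝒢.comp s Z → IsIso (τ.app Z)) (Y : C) :
    IsIso (τ.app Y) := by
  obtain ⟨D⟩ := 𝒢.decomposition Y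
  have := fun s => hτ s _ (D.mem s)
  refine ⟨∑ s, F'.map (D.π s) ≫ inv (τ.app (D.piece s)) ≫ F.map (D.ι s), ?_, ?_⟩
  · rw [Preadditive.comp_sum, ← F.map_id, ← D.sum_π_ι, F.map_sum]
    refine Finset.sum_congr rfl fun s _ => ?_
    rw [← NatTrans.naturality_assoc, IsIso.hom_inv_id_assoc, F.map_comp]
  · rw [Preadditive.sum_comp, ← F'.map_id, ← D.sum_π_ι, F'.map_sum]
    refine Finset.sum_congr rfl fun s _ => ?_
    rw [assoc, assoc, NatTrans.naturality, IsIso.inv_hom_id_assoc, F'.map_comp]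

instance RightAction.sumFunctor_additive {k : Type w} [Field k] {G : Type*} [Group G] [Fintype G]
    {C : Type u} [Category.{v} C] [Preadditive C] [HasFiniteBiproducts C] [Linear k C]
    (ρ : RightAction k G C) : ρ.sumFunctor.Additive where
  map_add {X Y f g} := by
    refine ρ.sum_hom_ext fun a => ?_
    rw [Preadditive.comp_add, ρ.incl_map, ρ.incl_map, ρ.incl_map, Functor.map_add,
      Preadditive.add_comp]

lemma RightAction.isIso_of_comp_eq_incl_tensor_incl {k : Type w} [Field k] {G : Type*} [Group G]
    [Fintype G] {C : Type u} [Category.{v} C] [Preadditive C] [HasFiniteBiproducts C]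
    [Linear k C] [MonoidalCategory C] [MonoidalPreadditive C] (ρ : RightAction k G C)
    {A X Y : C} {P : G × G → C}
    (f : A ⟶ ρ.sumFunctor.obj X ⊗ ρ.sumFunctor.obj Y) (ι : ∀ i, P i ⟶ A)
    (hι : ∀ {Z : C} {p q : A ⟶ Z}, (∀ i, ι i ≫ p = ι i ≫ q) → p = q)
    {σ : G × G → G × G} (hσ : Function.Bijective σ)
    (e : ∀ i, P i ⟶ (ρ.functor (σ i).1).obj X ⊗ (ρ.functor (σ i).2).obj Y)
    [∀ i, IsIso (e i)]
    (hf : ∀ i, ι i ≫ f = e i ≫ (ρ.incl X (σ i).1 ⊗ₘ ρ.incl Y (σ i).2)) :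
    IsIso f :=
  isIso_of_comp_eq_bicone_ι
    (isBilimitTensorBicone (biproduct.isBilimit fun g => (ρ.functor g).obj X)
      (biproduct.isBilimit fun g => (ρ.functor g).obj Y)) f ι hι hσ e hf

namespace MatchedPair

variable {G Γ : Type*} [Group G] [Group Γ] (M : MatchedPair G Γ)

lemma left_injective (s : Γ) : Function.Injective (M.left s) := fun g h hgh => by
  have := congrArg (M.left s⁻¹) hgh
  rwa [← M.mul_left, ← M.mul_left, inv_mul_cancel, M.one_left, M.one_left] at this

lemma bijective_leftFusion [Finite G] (s : Γ) : Function.Bijective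
    fun i : G × G => (M.left (M.right s i.2) i.1, i.2 * i.1) := by
  refine Finite.injective_iff_bijective.mp ?_
  rintro ⟨g, h⟩ ⟨g', h'⟩ heq
  obtain ⟨left_eq, mul_eq⟩ := Prod.mk.inj heq
  have left_mul_eq : M.left s (h * g) = M.left s (h' * g') := congrArg _ mul_eq
  dsimp only at left_eq mul_eq
  rw [M.left_mul, M.left_mul, left_eq, mul_left_inj] at left_mul_eq
  obtain rfl := M.left_injective s left_mul_eq
  rw [mul_left_cancel mul_eq]

lemma bijective_rightFusion [Finite G] (s : Γ) : Function.Bijective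
    fun i : G × G => (i.2 * M.left s i.1, i.1) := by
  refine Finite.injective_iff_bijective.mp ?_
  rintro ⟨g, h⟩ ⟨g', h'⟩ heq
  obtain ⟨mul_eq, rfl⟩ := Prod.mk.inj heq
  dsimp only at mul_eq
  rw [mul_right_cancel mul_eq]

end MatchedPair

namespace CrossedAction

variable {k : Type w} [Field k] {G Γ : Type*} [Group G] [Group Γ] [Fintype G] [Fintype Γ]
  {M : MatchedPair G Γ} {C : Type u} [Category.{v} C] [Preadditive C]
  [HasFiniteBiproducts C] [Linear k C] [MonoidalCategory C] [MonoidalPreadditive C]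
  (𝒜 : CrossedAction k M C)

lemma isIso_comul_mulApp_left_of_mem (X : C) {s : Γ} {Z : C} (hZ : 𝒜.grading.comp s Z) :
    IsIso (𝒜.comul X (𝒜.action.sumFunctor.obj Z) ≫
      𝒜.action.sumFunctor.obj X ◁ 𝒜.action.mulApp Z) := by
  have map_mem (h : G) : 𝒜.grading.comp (M.right s h) ((𝒜.action.functor h).obj Z) :=
    (𝒜.map_comp h s).le _ (ObjectProperty.prop_map_obj _ _ hZ)
  refine 𝒜.action.isIso_of_comp_eq_incl_tensor_incl _
    (fun i => (𝒜.action.functor i.1).map (X ◁ 𝒜.action.incl Z i.2) ≫ 𝒜.action.incl _ i.1)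
    (fun hpq => 𝒜.action.sum_hom_ext fun g => 𝒜.action.map_sum_hom_ext
      (tensorLeft X ⋙ 𝒜.action.functor g) fun h => by simpa using hpq (g, h))
    (M.bijective_leftFusion s)
    (fun i => (𝒜.γ i.1 X (map_mem i.2)).hom ≫ _ ◁ (𝒜.action.mul i.1 i.2).hom.app Z)
    fun ⟨g, h⟩ => ?_
  have incl_mul := 𝒜.action.incl_mulApp Z g h
  dsimp only
  rw [assoc, reassoc_of% 𝒜.map_whiskerLeft_comul g (X := X) (map_mem h) (𝒜.action.incl Z h),
    ← id_tensorHom, tensorHom_comp_tensorHom, assoc, incl_mul, comp_id, ← id_tensorHom, assoc,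
    tensorHom_comp_tensorHom, id_comp]

lemma isIso_comul_mulApp_right_of_mem (X : C) {s : Γ} {Z : C} (hZ : 𝒜.grading.comp s Z) :
    IsIso (𝒜.comul (𝒜.action.sumFunctor.obj X) Z ≫
      𝒜.action.mulApp X ▷ 𝒜.action.sumFunctor.obj Z) := by
  refine 𝒜.action.isIso_of_comp_eq_incl_tensor_incl _
    (fun i => (𝒜.action.functor i.1).map (𝒜.action.incl X i.2 ▷ Z) ≫ 𝒜.action.incl _ i.1)
    (fun hpq => 𝒜.action.sum_hom_ext fun g => 𝒜.action.map_sum_hom_ext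
      (tensorRight Z ⋙ 𝒜.action.functor g) fun h => by simpa using hpq (g, h))
    (M.bijective_rightFusion s)
    (fun i => (𝒜.γ i.1 ((𝒜.action.functor i.2).obj X) hZ).hom ≫
      (𝒜.action.mul (M.left s i.1) i.2).hom.app X ▷ _) fun ⟨g, h⟩ => ?_
  have incl_mul := 𝒜.action.incl_mulApp X (M.left s g) h
  dsimp only
  rw [assoc, ← tensorHom_id, reassoc_of% 𝒜.map_tensor_comul g hZ (𝒜.action.incl X h) (𝟙 Z),
    ← tensorHom_id, tensorHom_comp_tensorHom, assoc, incl_mul, comp_id,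
    CategoryTheory.Functor.map_id, id_comp, ← tensorHom_id, assoc, tensorHom_comp_tensorHom,
    id_comp]

lemma comul_naturality_right (X : C) {Y Y' : C} (q : Y ⟶ Y') :
    𝒜.action.sumFunctor.map (X ◁ q) ≫ 𝒜.comul X Y' =
      𝒜.comul X Y ≫ 𝒜.action.sumFunctor.obj X ◁ 𝒜.action.sumFunctor.map q := by
  rw [← id_tensorHom, ← id_tensorHom, ← CategoryTheory.Functor.map_id, comul_naturality]

lemma isIso_comul_mulApp_left (X Y : C) :
    IsIso (𝒜.comul X (𝒜.action.sumFunctor.obj Y) ≫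
      𝒜.action.sumFunctor.obj X ◁ 𝒜.action.mulApp Y) := by
  let fusion : 𝒜.action.sumFunctor ⋙ tensorLeft X ⋙ 𝒜.action.sumFunctor ⟶
      𝒜.action.sumFunctor ⋙ tensorLeft (𝒜.action.sumFunctor.obj X) :=
    { app := fun Y => 𝒜.comul X (𝒜.action.sumFunctor.obj Y) ≫
        𝒜.action.sumFunctor.obj X ◁ 𝒜.action.mulApp Y
      naturality := fun Y Y' f => by
        have mul_natural : 𝒜.action.sumFunctor.map (𝒜.action.sumFunctor.map f) ≫
            𝒜.action.mulApp Y' = 𝒜.action.mulApp Y ≫ 𝒜.action.sumFunctor.map f :=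
          𝒜.action.monad.μ.naturality f
        have comul_natural := 𝒜.comul_naturality_right X (𝒜.action.sumFunctor.map f)
        change 𝒜.action.sumFunctor.map (X ◁ 𝒜.action.sumFunctor.map f) ≫ _ ≫ _ =
          _ ≫ 𝒜.action.sumFunctor.obj X ◁ 𝒜.action.sumFunctor.map f
        rw [reassoc_of% comul_natural, assoc, ← whiskerLeft_comp, ← whiskerLeft_comp,
          mul_natural] }
  exact 𝒜.grading.isIso_app fusion (fun _ _ => 𝒜.isIso_comul_mulApp_left_of_mem X) Y

lemma isIso_comul_mulApp_right (X Y : C) :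
    IsIso (𝒜.comul (𝒜.action.sumFunctor.obj X) Y ≫
      𝒜.action.mulApp X ▷ 𝒜.action.sumFunctor.obj Y) := by
  let fusion : tensorLeft (𝒜.action.sumFunctor.obj X) ⋙ 𝒜.action.sumFunctor ⟶
      𝒜.action.sumFunctor ⋙ tensorLeft (𝒜.action.sumFunctor.obj X) :=
    { app := fun Y => 𝒜.comul (𝒜.action.sumFunctor.obj X) Y ≫
        𝒜.action.mulApp X ▷ 𝒜.action.sumFunctor.obj Y
      naturality := fun Y Y' f => by
        have comul_natural := 𝒜.comul_naturality_right (𝒜.action.sumFunctor.obj X) f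
        change 𝒜.action.sumFunctor.map (𝒜.action.sumFunctor.obj X ◁ f) ≫ _ ≫ _ =
          _ ≫ 𝒜.action.sumFunctor.obj X ◁ 𝒜.action.sumFunctor.map f
        rw [reassoc_of% comul_natural, assoc, whisker_exchange] }
  exact 𝒜.grading.isIso_app fusion (fun _ _ => 𝒜.isIso_comul_mulApp_right_of_mem X) Y

lemma isHopfMonad [Simple (𝟙_ C)] : IsHopfMonad 𝒜.action.monad 𝒜.monadOplaxMonoidal where
  __ := 𝒜.isBimonad
  left_fusion := 𝒜.isIso_comul_mulApp_left
  right_fusion := 𝒜.isIso_comul_mulApp_right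

end CrossedAction

/-! ### Equivariant objects as modules -/

namespace RightAction

variable {k : Type w} [Field k] {G : Type*} [Group G]
  {C : Type u} [Category.{v} C] [Preadditive C] [Linear k C]
  (ρ : RightAction k G C)

lemma isIso_of_act {X : C} (act : ∀ g : G, (ρ.functor g).obj X ⟶ X)
    (act_mul : ∀ g h, (ρ.functor g).map (act h) ≫ act g = (ρ.mul g h).hom.app X ≫ act (h * g))
    (act_one : ρ.one.hom.app X ≫ act 1 = 𝟙 X) (g : G) : IsIso (act g) := by
  have isIso_act_of_eq_one (a : G) (ha : a = 1) : IsIso (act a) := by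
    subst ha
    have : IsIso (ρ.one.hom.app X ≫ act 1) := by rw [act_one]; exact inferInstanceAs (IsIso (𝟙 X))
    exact IsIso.of_isIso_comp_left (ρ.one.hom.app X) (act 1)
  have isIso_map_act_comp (a b : G) (hab : b * a = 1) :
      IsIso ((ρ.functor a).map (act b) ≫ act a) := by
    have := isIso_act_of_eq_one (b * a) hab
    rw [act_mul]
    infer_instance
  have : IsSplitEpi (act g) := by
    have := isIso_map_act_comp g g⁻¹ (inv_mul_cancel g)
    exact ⟨⟨⟨inv ((ρ.functor g).map (act g⁻¹) ≫ act g) ≫ (ρ.functor g).map (act g⁻¹), by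
      rw [assoc, IsIso.inv_hom_id]⟩⟩⟩
  have : Mono (act g) := by
    have := isIso_map_act_comp g⁻¹ g (mul_inv_cancel g)
    exact (ρ.functor g⁻¹).mono_of_mono_map
      (mono_of_mono ((ρ.functor g⁻¹).map (act g)) (act g⁻¹))
  exact isIso_of_mono_of_isSplitEpi (act g)

variable [HasFiniteBiproducts C] [Fintype G]

lemma map_incl_comp {X : C} {a : ρ.sumFunctor.obj X ⟶ X}
    (h : ρ.mulApp X ≫ a = ρ.sumFunctor.map a ≫ a) (g g' : G) :
    (ρ.functor g).map (ρ.incl X g' ≫ a) ≫ ρ.incl X g ≫ a =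
      (ρ.mul g g').hom.app X ≫ ρ.incl X (g' * g) ≫ a := by
  have incl_map := ρ.incl_map a g
  have incl_mul := ρ.incl_mulApp X g g'
  rw [← reassoc_of% incl_mul, h, reassoc_of% incl_map, Functor.map_comp, assoc]

lemma one_incl_comp {X : C} {a : ρ.sumFunctor.obj X ⟶ X}
    (h : ρ.unitApp X ≫ a = 𝟙 X) : ρ.one.hom.app X ≫ ρ.incl X 1 ≫ a = 𝟙 X := by
  rw [← h, unitApp, assoc]

lemma incl_comp_comm {X Y : C} {a : ρ.sumFunctor.obj X ⟶ X}
    {b : ρ.sumFunctor.obj Y ⟶ Y} {f : X ⟶ Y} (h : ρ.sumFunctor.map f ≫ b = a ≫ f) (g : G) :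
    (ρ.incl X g ≫ a) ≫ f = (ρ.functor g).map f ≫ ρ.incl Y g ≫ b := by
  have incl_map := ρ.incl_map f g
  rw [assoc, ← h, reassoc_of% incl_map]

/-- The equivariant object of a `T`-module, whose action is the restriction of the module
structure to the summands of `T = ⨁ ρᵍ`. -/
def ofModules : ρ.monad.Algebra ⥤ EquivariantObject ρ where
  obj B :=
    { obj := B.A
      act := fun g => ρ.incl B.A g ≫ B.a
      isIso_act := ρ.isIso_of_act _ (ρ.map_incl_comp B.assoc) (ρ.one_incl_comp B.unit)
      act_mul := ρ.map_incl_comp B.assoc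
      act_one := ρ.one_incl_comp B.unit }
  map f :=
    { hom := f.f
      comm := ρ.incl_comp_comm f.h }

lemma desc_incl {X Z : C} (f : ρ.sumFunctor.obj X ⟶ Z) :
    ρ.desc (fun g => ρ.incl X g ≫ f) = f :=
  ρ.sum_hom_ext fun g => ρ.incl_desc _ g

/-- The equivalence between `T`-modules and equivariant objects, the identity on underlying
objects. -/
def modulesEquivalence : ρ.monad.Algebra ≌ EquivariantObject ρ where
  functor := ρ.ofModules
  inverse := ρ.toModules
  unitIso := NatIso.ofComponents
    (fun B => Monad.Algebra.isoMk (Iso.refl B.A) (by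
      change ρ.sumFunctor.map (𝟙 B.A) ≫ ρ.desc (fun g => ρ.incl B.A g ≫ B.a) = B.a ≫ 𝟙 B.A
      rw [CategoryTheory.Functor.map_id, id_comp, comp_id]
      exact ρ.desc_incl B.a))
    (fun {B B'} f => Monad.Algebra.Hom.ext' _ _ _ _
      (show f.f ≫ 𝟙 B'.A = 𝟙 B.A ≫ f.f by rw [id_comp, comp_id]))
  counitIso := NatIso.ofComponents
    (fun A =>
      { hom := ⟨𝟙 A.obj, fun g => by
          change (ρ.incl A.obj g ≫ ρ.desc A.act) ≫ 𝟙 A.obj =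
            (ρ.functor g).map (𝟙 A.obj) ≫ A.act g
          rw [ρ.incl_desc, CategoryTheory.Functor.map_id, id_comp, comp_id]⟩
        inv := ⟨𝟙 A.obj, fun g => by
          change A.act g ≫ 𝟙 A.obj =
            (ρ.functor g).map (𝟙 A.obj) ≫ ρ.incl A.obj g ≫ ρ.desc A.act
          rw [ρ.incl_desc, CategoryTheory.Functor.map_id, id_comp, comp_id]⟩
        hom_inv_id := EquivariantObject.hom_ext (id_comp (𝟙 A.obj))
        inv_hom_id := EquivariantObject.hom_ext (id_comp (𝟙 A.obj)) })
    (fun {A A'} f => EquivariantObject.hom_ext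
      (show f.hom ≫ 𝟙 A'.obj = 𝟙 A.obj ≫ f.hom by rw [id_comp, comp_id]))
  functor_unitIso_comp B := EquivariantObject.hom_ext (id_comp (𝟙 B.A))

lemma isEquivalence_toModules : ρ.toModules.IsEquivalence :=
  inferInstanceAs ρ.modulesEquivalence.inverse.IsEquivalence

end RightAction

namespace CrossedAction

variable {k : Type w} [Field k] {G Γ : Type*} [Group G] [Group Γ] [Fintype G] [Fintype Γ]
  {M : MatchedPair G Γ} {C : Type u} [Category.{v} C] [Preadditive C]
  [HasFiniteBiproducts C] [Linear k C] [MonoidalCategory C] [MonoidalPreadditive C]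
  (𝒜 : CrossedAction k M C)

lemma tensorAct_eq (A B : 𝒜.Equivariantization) (D : Decomposition 𝒜.grading.comp B.obj) (g : G) :
    𝒜.tensorAct A B D g = 𝒜.action.incl (A.obj ⊗ B.obj) g ≫ 𝒜.comul A.obj B.obj ≫
      (𝒜.action.desc A.act ⊗ₘ 𝒜.action.desc B.act) := by
  rw [𝒜.comul_eq_comulOf A.obj D, reassoc_of% 𝒜.incl_comulOf A.obj D g, Preadditive.sum_comp,
    tensorAct]
  refine Finset.sum_congr rfl fun s _ => ?_
  have map_mem := (𝒜.map_comp g s).le _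
    (ObjectProperty.prop_map_obj _ (𝒜.action.functor g) (D.mem s))
  have comp_π_ι := 𝒜.grading.comp_π_ι map_mem D ((𝒜.action.functor g).map (D.ι s) ≫ B.act g)
  rw [assoc] at comp_π_ι
  rw [assoc, assoc, tensorHom_comp_tensorHom, assoc, 𝒜.action.incl_desc, 𝒜.action.incl_desc,
    ← id_tensorHom A.obj (D.ι _), tensorHom_comp_tensorHom, comp_id, actPiece, assoc, assoc,
    comp_π_ι]

variable [Simple (𝟙_ C)]

/-- The monoidal structure of the equivariantization, transported from the modules over the Hopf
monad `T`. -/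
@[reducible]
def equivariantMonoidal : MonoidalCategory 𝒜.Equivariantization :=
  letI := 𝒜.isBimonad.algebraMonoidal
  Monoidal.transport 𝒜.action.modulesEquivalence

/-- The functor to modules as a monoidal functor. -/
@[reducible]
def toModulesMonoidal :
    letI := 𝒜.isBimonad.algebraMonoidal
    letI := 𝒜.equivariantMonoidal
    𝒜.action.toModules.Monoidal :=
  letI := 𝒜.isBimonad.algebraMonoidal
  (inferInstance :
    (Monoidal.equivalenceTransported 𝒜.action.modulesEquivalence).inverse.Monoidal)

/-- The forgetful functor from the equivariantization as a monoidal functor. -/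
@[reducible]
def forgetMonoidal :
    letI := 𝒜.equivariantMonoidal
    (EquivariantObject.forget 𝒜.action).Monoidal :=
  letI := 𝒜.isBimonad.algebraMonoidal
  letI := 𝒜.equivariantMonoidal
  letI := 𝒜.toModulesMonoidal
  letI := 𝒜.isBimonad.forgetMonoidal
  inferInstanceAs (𝒜.action.toModules ⋙ 𝒜.action.monad.forget).Monoidal

/-- Left and right duals in the equivariantization, transported from the modules over the Hopf
monad `T`. -/
@[reducible]
def equivariantRigid [RigidCategory C] :
    letI := 𝒜.equivariantMonoidal
    RigidCategory 𝒜.Equivariantization :=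
  letI := 𝒜.isBimonad.algebraMonoidal
  letI := 𝒜.equivariantMonoidal
  letI := 𝒜.toModulesMonoidal
  letI := 𝒜.isHopfMonad.algebraRigid
  haveI := 𝒜.action.isEquivalence_toModules
  rigidCategoryOfEquivalence 𝒜.action.modulesEquivalence.symm.toAdjunction

lemma isTwistedMonoidal :
    letI := 𝒜.equivariantMonoidal
    𝒜.IsTwistedMonoidal :=
  letI := 𝒜.equivariantMonoidal
  { tensor_obj := fun _ _ => rfl
    tensor_act := fun A B D g => by
      change 𝒜.action.incl (A.obj ⊗ B.obj) g ≫ 𝒜.comul A.obj B.obj ≫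
          (𝒜.action.desc A.act ⊗ₘ 𝒜.action.desc B.act) =
        (𝒜.action.functor g).map (𝟙 (A.obj ⊗ B.obj)) ≫ 𝒜.tensorAct A B D g ≫ 𝟙 (A.obj ⊗ B.obj)
      rw [CategoryTheory.Functor.map_id, id_comp, comp_id, 𝒜.tensorAct_eq]
    unit_obj := rfl
    unit_act := fun g => by
      change 𝒜.action.incl (𝟙_ C) g ≫ 𝒜.counit =
        (𝒜.action.functor g).map (𝟙 (𝟙_ C)) ≫ (𝒜.γ₀ g).hom ≫ 𝟙 (𝟙_ C)
      rw [CategoryTheory.Functor.map_id, id_comp, comp_id]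
      exact 𝒜.action.incl_desc _ g
    forget_strict := ⟨𝒜.forgetMonoidal, fun A B => id_comp _, id_comp _⟩ }

end CrossedAction

/-! ### The equivariantization as a tensor category -/

section Conservative

variable {D C : Type*} [Category* D] [Category* C] (U : D ⥤ C)

lemma isIso_coimageImageComparison_of_conservative [Preadditive D] [Abelian C]
    [U.PreservesZeroMorphisms] [U.ReflectsIsomorphisms] [HasKernels D] [HasCokernels D]
    [PreservesLimitsOfShape WalkingParallelPair U]
    [PreservesColimitsOfShape WalkingParallelPair U] {X Y : D} (f : X ⟶ Y) :
    IsIso (Abelian.coimageImageComparison f) := by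
  have : IsIso (U.map (Abelian.coimageImageComparison f)) := by
    rw [Arrow.isIso_iff_isIso_of_isIso (Abelian.PreservesCoimageImageComparison.iso U f).hom]
    infer_instance
  exact isIso_of_reflects_iso _ U

variable [U.PreservesMonomorphisms] [U.ReflectsIsomorphisms]

lemma strictMono_subobject_map (X : D) :
    StrictMono fun S : Subobject X => Subobject.mk (U.map S.arrow) := by
  intro S S' hlt
  let inclusion := Subobject.ofLE S S' hlt.le
  have map_inclusion : U.map inclusion ≫ U.map S'.arrow = U.map S.arrow := by
    rw [← U.map_comp, Subobject.ofLE_arrow]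
  refine (Subobject.mk_le_mk_of_comm _ map_inclusion).lt_of_ne fun heq => hlt.not_ge ?_
  have : IsIso (U.map inclusion) := by
    have : U.map inclusion = (Subobject.isoOfMkEqMk _ _ heq).hom := by
      rw [← cancel_mono (U.map S'.arrow), map_inclusion]
      simp
    rw [this]
    infer_instance
  have : IsIso inclusion := isIso_of_reflects_iso inclusion U
  exact Subobject.le_of_comm (inv inclusion) (by simp [inclusion])

lemma isNoetherianObject_of_conservative (X : D) [IsNoetherianObject (U.obj X)] :
    IsNoetherianObject X :=
  ⟨(strictMono_subobject_map U X).wellFoundedGT⟩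

lemma isArtinianObject_of_conservative (X : D) [IsArtinianObject (U.obj X)] :
    IsArtinianObject X :=
  ⟨(strictMono_subobject_map U X).wellFoundedLT⟩

lemma simple_of_conservative [HasZeroMorphisms D] [HasZeroMorphisms C]
    [U.PreservesZeroMorphisms] [U.Faithful] {X : D} (h : Simple (U.obj X)) : Simple X where
  mono_isIso_iff_nonzero f _ := by
    rw [← isIso_iff_of_reflects_iso f U, h.mono_isIso_iff_nonzero, Ne, U.map_eq_zero_iff]

end Conservative

lemma RightAction.preservesColimitsOfShape_sumFunctor {k : Type w} [Field k] {G : Type*} [Group G]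
    [Fintype G] {C : Type u} [Category.{v} C] [Preadditive C] [HasFiniteBiproducts C]
    [Linear k C] (ρ : RightAction k G C) (J : Type*) [Category* J] :
    PreservesColimitsOfShape J ρ.sumFunctor := by
  let summands : C ⥤ Discrete G ⥤ C :=
    { obj := fun X => Discrete.functor fun g => (ρ.functor g).obj X
      map := fun f => Discrete.natTrans fun g => (ρ.functor g.as).map f }
  have : PreservesColimitsOfShape J summands :=
    ⟨⟨fun hc => ⟨evaluationJointlyReflectsColimits _ fun g =>
      isColimitOfPreserves (ρ.functor g.as) hc⟩⟩⟩
  let e : summands ⋙ colim ≅ ρ.sumFunctor := NatIso.ofComponents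
    (fun X => (biproduct.isoCoproduct fun g => (ρ.functor g).obj X).symm)
    (fun f => colimit.hom_ext fun g => by simp [RightAction.sumFunctor, summands])
  exact preservesColimitsOfShape_of_natIso e

namespace EquivariantObject

variable {k : Type w} [Field k] {G : Type*} [Group G]
  {C : Type u} [Category.{v} C]

section Linear

variable [Preadditive C] [Linear k C]

instance (ρ : RightAction k G C) : (forget ρ).Faithful where
  map_injective h := hom_ext h

instance (ρ : RightAction k G C) : (forget ρ).PreservesZeroMorphisms where
  map_zero _ _ := rfl

instance (ρ : RightAction k G C) : (forget ρ).ReflectsIsomorphisms where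
  reflects {X Y} f hf := by
    have : IsIso f.hom := hf
    refine ⟨⟨inv f.hom, fun g => ?_⟩, hom_ext (IsIso.hom_inv_id f.hom),
      hom_ext (IsIso.inv_hom_id f.hom)⟩
    rw [Functor.map_inv, IsIso.eq_inv_comp, ← reassoc_of% f.comm g, IsIso.hom_inv_id, comp_id]

lemma finite_hom {ρ : RightAction k G C} (X Y : EquivariantObject ρ)
    [Module.Finite k (X.obj ⟶ Y.obj)] : Module.Finite k (X ⟶ Y) :=
  Module.Finite.of_injective
    ({ toFun := fun f => f.hom
       map_add' := fun _ _ => rfl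
       map_smul' := fun _ _ => rfl } : (X ⟶ Y) →ₗ[k] (X.obj ⟶ Y.obj))
    fun _ _ h => hom_ext h

end Linear

variable [Finite G]

instance [Preadditive C] [HasFiniteBiproducts C] [Linear k C] (ρ : RightAction k G C) :
    (forget ρ).PreservesMonomorphisms :=
  have := Fintype.ofFinite G
  have := ρ.isEquivalence_toModules
  inferInstanceAs (ρ.toModules ⋙ ρ.monad.forget).PreservesMonomorphisms

lemma exists_abelian [Abelian C] [Linear k C] (ρ : RightAction k G C) :
    ∃ A : Abelian (EquivariantObject ρ), A.toPreadditive = (inferInstance : Preadditive _) := by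
  have := Fintype.ofFinite G
  have := Abelian.hasFiniteBiproducts (C := C)
  have := ρ.isEquivalence_toModules
  have : PreservesColimitsOfShape WalkingParallelPair ρ.monad.toFunctor :=
    ρ.preservesColimitsOfShape_sumFunctor _
  have : HasFiniteLimits ρ.monad.Algebra :=
    ⟨fun _ _ _ => ⟨fun _ => Monad.hasLimit_of_comp_forget_hasLimit _⟩⟩
  have : HasColimitsOfShape WalkingParallelPair ρ.monad.Algebra :=
    ⟨fun _ => Monad.forget_creates_colimits_of_monad_preserves _⟩
  have : HasFiniteLimits (EquivariantObject ρ) :=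
    ⟨fun _ _ _ => Adjunction.hasLimitsOfShape_of_equivalence ρ.toModules⟩
  have : HasColimitsOfShape WalkingParallelPair (EquivariantObject ρ) :=
    Adjunction.hasColimitsOfShape_of_equivalence ρ.toModules
  have : HasCokernels (EquivariantObject ρ) := ⟨inferInstance⟩
  have : PreservesLimitsOfShape WalkingParallelPair (forget ρ) :=
    inferInstanceAs (PreservesLimitsOfShape _ (ρ.toModules ⋙ ρ.monad.forget))
  have : PreservesColimitsOfShape WalkingParallelPair (forget ρ) :=
    inferInstanceAs (PreservesColimitsOfShape _ (ρ.toModules ⋙ ρ.monad.forget))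
  have (X Y : EquivariantObject ρ) (f : X ⟶ Y) :=
    isIso_coimageImageComparison_of_conservative (forget ρ) f
  exact ⟨Abelian.ofCoimageImageComparisonIsIso, rfl⟩

end EquivariantObject

namespace CrossedAction

variable {k : Type w} [Field k] {G Γ : Type*} [Group G] [Group Γ] [Fintype G] [Fintype Γ]
  {M : MatchedPair G Γ} {C : Type u} [Category.{v} C] [Preadditive C] [HasFiniteBiproducts C]
  [Linear k C] [MonoidalCategory C] [MonoidalPreadditive C] [Simple (𝟙_ C)]
  (𝒜 : CrossedAction k M C)

lemma equivariant_monoidalPreadditive :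
    letI := 𝒜.equivariantMonoidal
    MonoidalPreadditive 𝒜.Equivariantization :=
  letI := 𝒜.equivariantMonoidal
  { whiskerLeft_zero := EquivariantObject.hom_ext MonoidalPreadditive.whiskerLeft_zero
    zero_whiskerRight := EquivariantObject.hom_ext MonoidalPreadditive.zero_whiskerRight
    whiskerLeft_add := fun f g => EquivariantObject.hom_ext
      (MonoidalPreadditive.whiskerLeft_add f.hom g.hom)
    add_whiskerRight := fun f g => EquivariantObject.hom_ext
      (MonoidalPreadditive.add_whiskerRight f.hom g.hom) }

lemma equivariant_monoidalLinear [MonoidalLinear k C] :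
    letI := 𝒜.equivariantMonoidal
    letI := 𝒜.equivariant_monoidalPreadditive
    MonoidalLinear k 𝒜.Equivariantization :=
  letI := 𝒜.equivariantMonoidal
  letI := 𝒜.equivariant_monoidalPreadditive
  { whiskerLeft_smul := fun X _ _ r f => EquivariantObject.hom_ext
      (MonoidalLinear.whiskerLeft_smul X.obj r f.hom)
    smul_whiskerRight := fun r _ _ f X => EquivariantObject.hom_ext
      (MonoidalLinear.smul_whiskerRight r f.hom X.obj) }

lemma isTensorCategory_equivariantization (hC : IsTensorCategory k C) :
    letI := 𝒜.equivariantMonoidal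
    IsTensorCategory k 𝒜.Equivariantization :=
  letI := 𝒜.equivariantMonoidal
  { abelian := by
      obtain ⟨_, rfl⟩ := hC.abelian
      exact EquivariantObject.exists_abelian 𝒜.action
    tensor_bilinear := by
      obtain ⟨_, _⟩ := hC.tensor_bilinear
      exact ⟨𝒜.equivariant_monoidalPreadditive, 𝒜.equivariant_monoidalLinear⟩
    rigid := by
      obtain ⟨_⟩ := hC.rigid
      exact ⟨𝒜.equivariantRigid⟩
    noetherian := fun X =>
      have : IsNoetherianObject ((EquivariantObject.forget 𝒜.action).obj X) := hC.noetherian X.obj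
      isNoetherianObject_of_conservative (EquivariantObject.forget 𝒜.action) X
    artinian := fun X =>
      have : IsArtinianObject ((EquivariantObject.forget 𝒜.action).obj X) := hC.artinian X.obj
      isArtinianObject_of_conservative (EquivariantObject.forget 𝒜.action) X
    finite_hom := fun X Y =>
      have := hC.finite_hom X.obj Y.obj
      EquivariantObject.finite_hom X Y
    simple_unit := simple_of_conservative (EquivariantObject.forget _) hC.simple_unit }

lemma toModules_tensor_a (A B : 𝒜.Equivariantization) :
    letI := 𝒜.equivariantMonoidal
    (𝒜.action.toModules.obj (A ⊗ B)).a = 𝒜.comul A.obj B.obj ≫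
      ((𝒜.action.toModules.obj A).a ⊗ₘ (𝒜.action.toModules.obj B).a) :=
  𝒜.action.desc_incl _

end CrossedAction

end CrossedTensor

end

theorem theorem5p1_general {k : Type w} [Field k]
    {G Γ : Type*} [Group G] [Group Γ] [Fintype G] [Fintype Γ]
    (M : CrossedTensor.MatchedPair G Γ)
    {C : Type u} [Category.{v} C] [Preadditive C] [HasFiniteBiproducts C]
    [Linear k C] [MonoidalCategory C]
    (hC : CrossedTensor.IsTensorCategory k C)
    (𝒜 : CrossedTensor.CrossedAction k M C) :
    ∃ _ : MonoidalCategory 𝒜.Equivariantization,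
      CrossedTensor.IsTensorCategory k 𝒜.Equivariantization ∧
      ∃ h : 𝒜.IsTwistedMonoidal,
      ∃ O : 𝒜.action.monad.toFunctor.OplaxMonoidal,
        (∀ (X Y : C) (D : CrossedTensor.Decomposition 𝒜.grading.comp Y),
          O.δ X Y = 𝒜.comulApp X D) ∧
        O.η = 𝒜.counitHom ∧
        CrossedTensor.IsHopfMonad 𝒜.action.monad O ∧
        𝒜.action.toModules.IsEquivalence ∧
        ∀ A B : 𝒜.Equivariantization,
          (𝒜.action.toModules.obj (A ⊗ B)).a =
            𝒜.action.monad.map (eqToHom (h.tensor_obj A B)) ≫ O.δ A.obj B.obj ≫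
              ((𝒜.action.toModules.obj A).a ⊗ₘ (𝒜.action.toModules.obj B).a) ≫
              eqToHom (h.tensor_obj A B).symm := by
  obtain ⟨_, _⟩ := hC.tensor_bilinear
  have := hC.simple_unit
  refine ⟨𝒜.equivariantMonoidal, 𝒜.isTensorCategory_equivariantization hC, 𝒜.isTwistedMonoidal,
    𝒜.monadOplaxMonoidal, fun X _ D => 𝒜.comul_eq_comulOf X D, rfl, 𝒜.isHopfMonad,
    𝒜.action.isEquivalence_toModules, fun A B => ?_⟩
  change _ = 𝒜.action.sumFunctor.map (𝟙 (A.obj ⊗ B.obj)) ≫ 𝒜.comul A.obj B.obj ≫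
    (𝒜.action.desc A.act ⊗ₘ 𝒜.action.desc B.act) ≫ 𝟙 (A.obj ⊗ B.obj)
  rw [CategoryTheory.Functor.map_id, id_comp, comp_id]
  exact 𝒜.toModules_tensor_a A B

theorem theorem5p1 {k : Type w} [Field k] [IsAlgClosed k]
    {G Γ : Type*} [Group G] [Group Γ] [Fintype G] [Fintype Γ]
    (M : CrossedTensor.MatchedPair G Γ)
    {C : Type u} [Category.{v} C] [Preadditive C] [HasFiniteBiproducts C]
    [Linear k C] [MonoidalCategory C]
    (hC : CrossedTensor.IsTensorCategory k C)
    (𝒜 : CrossedTensor.CrossedAction k M C) :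
    ∃ _ : MonoidalCategory 𝒜.Equivariantization,
      CrossedTensor.IsTensorCategory k 𝒜.Equivariantization ∧
      ∃ h : 𝒜.IsTwistedMonoidal,
      ∃ O : 𝒜.action.monad.toFunctor.OplaxMonoidal,
        (∀ (X Y : C) (D : CrossedTensor.Decomposition 𝒜.grading.comp Y),
          O.δ X Y = 𝒜.comulApp X D) ∧
        O.η = 𝒜.counitHom ∧
        CrossedTensor.IsHopfMonad 𝒜.action.monad O ∧
        𝒜.action.toModules.IsEquivalence ∧
        ∀ A B : 𝒜.Equivariantization,
          (𝒜.action.toModules.obj (A ⊗ B)).a =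
            𝒜.action.monad.map (eqToHom (h.tensor_obj A B)) ≫ O.δ A.obj B.obj ≫
              ((𝒜.action.toModules.obj A).a ⊗ₘ (𝒜.action.toModules.obj B).a) ≫
              eqToHom (h.tensor_obj A B).symm :=
  theorem5p1_general M hC 𝒜
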